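/- Let $\mathbb{K}\in\{\mathbb{R},\mathbb{C}\}$, let $\Omega\subset\mathbb{R}^n$ be a bounded domain (a nonempty bounded connected open set, with no regularity assumption on the boundary), and let $T>0$. All functions are $\mathbb{K}$-valued unless stated otherwise. $H^1_0(\Omega)$ is the closure of $C_c^\infty(\Omega)$ in $H^1(\Omega)$, with the norm $(\|u\|_{L^2}^2+\|\nabla u\|_{L^2}^2)^{1/2}$. $H^{-1}(\Omega)$ is its (anti-)dual, i.e. the space of bounded conjugate-linear functionals on $H^1_0(\Omega)$, with duality pairing $\langle\cdot,\cdot\rangle$. The space $L^2(\Omega)$ is embedded in $H^{-1}(\Omega)$ by $\langle h,v\rangle=(h,v)_{L^2(\Omega)}=\int_\Omega h\,\overline{v}\,dx$. Let $V\in L^\infty(\Omega)$ be real-valued with $V\ge 0$ almost everywhere, $f\in L^2([0,T];L^2(\Omega))$, $u_0\in H^1_0(\Omega)$ and $u_1\in L^2(\Omega)$. A weak solution of $$\partial_t^2u-\Delta u+Vu=f \ \text{ in } [0,T]\times\Omega,\qquad u(0,\cdot)=u_0,\quad \partial_tu(0,\cdot)=u_1 \ \text{ in } \Omega,\qquad u=0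 \ \text{ on } [0,T]\times\partial\Omega,$$ is a $u\in L^2([0,T];H^1_0(\Omega))$ whose weak time derivatives satisfy $\partial_tu\in L^\infty([0,T];L^2(\Omega))$ and $\partial_t^2u\in L^2([0,T];H^{-1}(\Omega))$, which satisfies $u(0)=u_0$ and $\partial_tu(0)=u_1$ (for the continuous representatives $u\in C([0,T];L^2(\Omega))$ and $\partial_tu\in C([0,T];H^{-1}(\Omega))$), and such that for all $v\in L^2([0,T];H^1_0(\Omega))$ $$\int_0^T\Big(\langle\partial_t^2u,v\rangle+(\nabla u,\nabla v)_{L^2(\Omega)}+(\sqrt V u,\sqrt V v)_{L^2(\Omega)}\Big)\,dt=\int_0^T(f,v)_{L^2(\Omega)}\,dt.$$ Theorem. Under these assumptions there exists exactly one weak solution $u\in L^2([0,T];H^1_0(\Omega))$. -/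

import Mathlib

open MeasureTheory Set Filter
open scoped ENNReal ContDiff

noncomputable section

namespace WaveDirichlet

/-- `L²(Ω)`, scalar (real or complex) valued. -/
abbrev L2 (𝕜 : Type*) [RCLike 𝕜] {n : ℕ} (Ω : Set (EuclideanSpace ℝ (Fin n))) :=
  Lp 𝕜 2 (volume.restrict Ω)

/-- `L²(Ω)ⁿ`, the space of square integrable vector fields. -/
abbrev L2Vec (𝕜 : Type*) [RCLike 𝕜] {n : ℕ} (Ω : Set (EuclideanSpace ℝ (Fin n))) :=
  Lp (EuclideanSpace 𝕜 (Fin n)) 2 (volume.restrict Ω)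

/-- The classical gradient `(∂₁φ, …, ∂ₙφ)` of a scalar valued function on `ℝⁿ`. -/
def classicalGrad (𝕜 : Type*) [RCLike 𝕜] {n : ℕ} (φ : EuclideanSpace ℝ (Fin n) → 𝕜)
    (x : EuclideanSpace ℝ (Fin n)) : EuclideanSpace 𝕜 (Fin n) :=
  WithLp.toLp 2 fun i => fderiv ℝ φ x (EuclideanSpace.single i 1)

/-- `φ ∈ C_c^∞(Ω)`: smooth functions on `ℝⁿ` with compact support contained in `Ω`. -/
structure IsTestFunction {𝕜 : Type*} [RCLike 𝕜] {n : ℕ} (Ω : Set (EuclideanSpace ℝ (Fin n)))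
    (φ : EuclideanSpace ℝ (Fin n) → 𝕜) : Prop where
  smooth : ContDiff ℝ ∞ φ
  compact : HasCompactSupport φ
  subset : tsupport φ ⊆ Ω

/-- `G` is the weak (distributional) gradient of `u` in `Ω`:
`∫_Ω u ∂ᵢφ = - ∫_Ω Gᵢ φ` for all `φ ∈ C_c^∞(Ω)` and all `i`. -/
def IsWeakGrad {𝕜 : Type*} [RCLike 𝕜] {n : ℕ} (Ω : Set (EuclideanSpace ℝ (Fin n)))
    (u : L2 𝕜 Ω) (G : L2Vec 𝕜 Ω) : Prop :=
  ∀ φ : EuclideanSpace ℝ (Fin n) → 𝕜, IsTestFunction Ω φ → ∀ i : Fin n,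
    ∫ x in Ω, u x * fderiv ℝ φ x (EuclideanSpace.single i 1) = - ∫ x in Ω, G x i * φ x

/-- The pairs `(φ, ∇φ)`, `φ ∈ C_c^∞(Ω)`, in `L²(Ω) × L²(Ω)ⁿ` with the Hilbert norm
`(‖u‖² + ‖G‖²)^{1/2}`. -/
def testPairs (𝕜 : Type*) [RCLike 𝕜] {n : ℕ} (Ω : Set (EuclideanSpace ℝ (Fin n))) :
    Set (WithLp 2 (L2 𝕜 Ω × L2Vec 𝕜 Ω)) :=
  {p | ∃ φ : EuclideanSpace ℝ (Fin n) → 𝕜, IsTestFunction Ω φ ∧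
    p.fst =ᵐ[volume.restrict Ω] φ ∧ p.snd =ᵐ[volume.restrict Ω] classicalGrad 𝕜 φ}

/-- `H¹₀(Ω)`, the closure of `C_c^∞(Ω)` in the norm `(‖u‖² + ‖∇u‖²)^{1/2}` of `H¹(Ω)`.
An element `u` is recorded as the pair `(u, ∇u)` of `u` and its weak gradient
(see `isWeakGrad_of_mem_H10`). -/
def H10 (𝕜 : Type*) [RCLike 𝕜] {n : ℕ} (Ω : Set (EuclideanSpace ℝ (Fin n))) :
    Submodule 𝕜 (WithLp 2 (L2 𝕜 Ω × L2Vec 𝕜 Ω)) :=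
  (Submodule.span 𝕜 (testPairs 𝕜 Ω)).topologicalClosure

section
variable {𝕜 : Type*} [RCLike 𝕜] {n : ℕ} {Ω : Set (EuclideanSpace ℝ (Fin n))}

/-- Test functions, with their classical gradient, are elements of `H¹₀(Ω)`. -/
theorem exists_mem_H10_of_isTestFunction {φ : EuclideanSpace ℝ (Fin n) → 𝕜}
    (hφ : IsTestFunction Ω φ) :
    ∃ p ∈ H10 𝕜 Ω, p.fst =ᵐ[volume.restrict Ω] φ ∧
      p.snd =ᵐ[volume.restrict Ω] classicalGrad 𝕜 φ := by
  have hd : Continuous (fderiv ℝ φ) := hφ.smooth.continuous_fderiv (by simp)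
  have h1 : MemLp φ 2 (volume.restrict Ω) :=
    (hφ.smooth.continuous.memLp_of_hasCompactSupport hφ.compact).restrict Ω
  have h2 : MemLp (classicalGrad 𝕜 φ) 2 (volume.restrict Ω) := by
    refine (Continuous.memLp_of_hasCompactSupport ?_ ?_).restrict Ω
    · unfold classicalGrad
      refine (PiLp.continuous_toLp 2 _).comp (continuous_pi fun i => ?_)
      exact hd.clm_apply continuous_const
    · refine (hφ.compact.fderiv ℝ).mono fun x hx => ?_
      simp only [Function.mem_support] at hx ⊢
      intro h
      apply hx
      simp only [classicalGrad, h]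
      rfl
  refine ⟨WithLp.toLp 2 (h1.toLp φ, h2.toLp _), ?_, h1.coeFn_toLp, h2.coeFn_toLp⟩
  exact Submodule.le_topologicalClosure _
    (Submodule.subset_span ⟨φ, hφ, h1.coeFn_toLp, h2.coeFn_toLp⟩)

/-- For `p ∈ H¹₀(Ω)` the second component is the weak gradient of the first one. -/
theorem isWeakGrad_of_mem_H10 {p : WithLp 2 (L2 𝕜 Ω × L2Vec 𝕜 Ω)} (hp : p ∈ H10 𝕜 Ω) :
    IsWeakGrad Ω p.fst p.snd := by
  intro φ hφ i
  set e : EuclideanSpace ℝ (Fin n) := EuclideanSpace.single i 1 with he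
  have hc : Continuous φ := hφ.smooth.continuous
  have hd : Continuous (fun x => fderiv ℝ φ x e) :=
    (hφ.smooth.continuous_fderiv (by simp)).clm_apply continuous_const
  have hdc : HasCompactSupport (fun x => fderiv ℝ φ x e) := hφ.compact.fderiv_apply ℝ e
  have m1 : MemLp (fun x => (starRingEnd 𝕜) (fderiv ℝ φ x e)) 2 (volume.restrict Ω) := by
    refine (Continuous.memLp_of_hasCompactSupport (RCLike.continuous_conj.comp hd) ?_).restrict Ω
    exact hdc.comp_left (g := starRingEnd 𝕜) (map_zero _)
  have m2 : MemLp (fun x => (EuclideanSpace.single i ((starRingEnd 𝕜) (φ x)) :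
      EuclideanSpace 𝕜 (Fin n))) 2 (volume.restrict Ω) := by
    refine (Continuous.memLp_of_hasCompactSupport ?_ ?_).restrict Ω
    · refine (PiLp.continuous_toLp 2 _).comp (continuous_pi fun j => ?_)
      by_cases h : j = i
      · subst h; simp only [Pi.single_eq_same]; exact (RCLike.continuous_conj (K := 𝕜)).comp hc
      · simpa [h] using continuous_const
    · exact hφ.compact.comp_left (g := fun z : 𝕜 =>
        (EuclideanSpace.single i ((starRingEnd 𝕜) z) : EuclideanSpace 𝕜 (Fin n))) (by simp)
  let L : WithLp 2 (L2 𝕜 Ω × L2Vec 𝕜 Ω) →L[𝕜] 𝕜 :=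
    (innerSL 𝕜 (m1.toLp _)).comp (WithLp.fstL 2 𝕜 (L2 𝕜 Ω) (L2Vec 𝕜 Ω)) +
    (innerSL 𝕜 (m2.toLp _)).comp (WithLp.sndL 2 𝕜 (L2 𝕜 Ω) (L2Vec 𝕜 Ω))
  have hL : ∀ q, L q = (∫ x in Ω, q.fst x * fderiv ℝ φ x e) + ∫ x in Ω, q.snd x i * φ x := by
    intro q
    change inner 𝕜 (m1.toLp _) q.fst + inner 𝕜 (m2.toLp _) q.snd = _
    rw [L2.inner_def, L2.inner_def]
    congr 1
    · refine integral_congr_ae ?_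
      filter_upwards [m1.coeFn_toLp] with x hx
      rw [hx]
      simp [RCLike.inner_apply]
    · refine integral_congr_ae ?_
      filter_upwards [m2.coeFn_toLp] with x hx
      rw [hx]
      simp [EuclideanSpace.inner_single_left, mul_comm]
  have hle : H10 𝕜 Ω ≤ L.ker := by
    refine Submodule.topologicalClosure_minimal _ (Submodule.span_le.2 ?_) L.isClosed_ker
    rintro q ⟨ψ, hψ, hq1, hq2⟩
    have hψc : Continuous ψ := hψ.smooth.continuous
    have hψd : Continuous (fun x => fderiv ℝ ψ x e) :=
      (hψ.smooth.continuous_fderiv (by simp)).clm_apply continuous_const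
    have hψdc : HasCompactSupport (fun x => fderiv ℝ ψ x e) := hψ.compact.fderiv_apply ℝ e
    change L q = 0
    have e1 : ∫ x in Ω, q.fst x * fderiv ℝ φ x e = ∫ x in Ω, ψ x * fderiv ℝ φ x e :=
      integral_congr_ae (by filter_upwards [hq1] with x hx; rw [hx])
    have e2 : ∫ x in Ω, q.snd x i * φ x = ∫ x in Ω, fderiv ℝ ψ x e * φ x :=
      integral_congr_ae (by filter_upwards [hq2] with x hx; rw [hx]; rfl)
    rw [hL, e1, e2]
    have z1 : ∀ x, x ∉ Ω → ψ x = 0 := fun x hx =>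
      image_eq_zero_of_notMem_tsupport fun h => hx (hψ.subset h)
    have z2 : ∀ x, x ∉ Ω → φ x = 0 := fun x hx =>
      image_eq_zero_of_notMem_tsupport fun h => hx (hφ.subset h)
    rw [setIntegral_eq_integral_of_forall_compl_eq_zero (fun x hx => by rw [z1 x hx, zero_mul]),
      setIntegral_eq_integral_of_forall_compl_eq_zero (fun x hx => by rw [z2 x hx, mul_zero]),
      integral_mul_fderiv_eq_neg_fderiv_mul_of_integrable]
    · simp
    · exact (hψd.mul hc).integrable_of_hasCompactSupport hψdc.mul_right
    · exact (hψc.mul hd).integrable_of_hasCompactSupport hψ.compact.mul_right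
    · exact (hψc.mul hc).integrable_of_hasCompactSupport hψ.compact.mul_right
    · exact fun x _ => hψ.smooth.differentiable (by simp) x
    · exact fun x _ => hφ.smooth.differentiable (by simp) x
  have h0 : L p = 0 := hle hp
  rw [hL] at h0
  exact eq_neg_of_add_eq_zero_left h0

/-- The inclusion `H¹₀(Ω) → L²(Ω)`. -/
def toL2 : H10 𝕜 Ω →L[𝕜] L2 𝕜 Ω :=
  (WithLp.fstL 2 𝕜 (L2 𝕜 Ω) (L2Vec 𝕜 Ω)).comp (H10 𝕜 Ω).subtypeL

/-- The weak gradient `∇ : H¹₀(Ω) → L²(Ω)ⁿ`. -/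
def grad : H10 𝕜 Ω →L[𝕜] L2Vec 𝕜 Ω :=
  (WithLp.sndL 2 𝕜 (L2 𝕜 Ω) (L2Vec 𝕜 Ω)).comp (H10 𝕜 Ω).subtypeL

end

/-- `H⁻¹(Ω)`: the bounded conjugate-linear functionals on `H¹₀(Ω)` (over `ℝ` this is the dual
space), with the operator norm. The duality pairing `⟨ℓ, v⟩` is `ℓ v`. -/
abbrev Hm1 (𝕜 : Type*) [RCLike 𝕜] {n : ℕ} (Ω : Set (EuclideanSpace ℝ (Fin n))) :=
  H10 𝕜 Ω →L⋆[𝕜] 𝕜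

/-- The embedding `L²(Ω) → H⁻¹(Ω)`, `⟨h, v⟩ = (h, v)_{L²(Ω)} = ∫_Ω h v̄`
(Mathlib's inner product is conjugate-linear in its first argument). -/
def toHm1 {𝕜 : Type*} [RCLike 𝕜] {n : ℕ} {Ω : Set (EuclideanSpace ℝ (Fin n))}
    (h : L2 𝕜 Ω) : Hm1 𝕜 Ω :=
  (innerSLFlip 𝕜 h).comp toL2

/-- Lebesgue measure on the time interval `[0, T]`. -/
abbrev timeMeasure (T : ℝ) : Measure ℝ := volume.restrict (Icc 0 T)

/-- `w'` is the weak time derivative of `w` on `(0, T)`: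
`∫₀ᵀ φ'(t) w(t) dt = - ∫₀ᵀ φ(t) w'(t) dt` for all `φ ∈ C_c^∞(0, T)`. -/
def IsWeakTimeDeriv {X : Type*} [NormedAddCommGroup X] [NormedSpace ℝ X] (T : ℝ)
    (w w' : ℝ → X) : Prop :=
  ∀ φ : ℝ → ℝ, ContDiff ℝ ∞ φ → HasCompactSupport φ → tsupport φ ⊆ Ioo 0 T →
    ∫ t in Icc 0 T, deriv φ t • w t = - ∫ t in Icc 0 T, φ t • w' t

/-- `w(0) = x`, in the sense that `w` has a representative that is continuous on `[0, T]` and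
takes the value `x` at `0`. -/
def HasInitialValue {X : Type*} [TopologicalSpace X] (T : ℝ) (w : ℝ → X) (x : X) : Prop :=
  ∃ c : ℝ → X, ContinuousOn c (Icc 0 T) ∧ c =ᵐ[timeMeasure T] w ∧ c 0 = x

/-- `(√V u, √V v)_{L²(Ω)}`. -/
def potentialForm {𝕜 : Type*} [RCLike 𝕜] {n : ℕ} {Ω : Set (EuclideanSpace ℝ (Fin n))}
    (V : Lp ℝ ∞ (volume.restrict Ω)) (u v : L2 𝕜 Ω) : 𝕜 :=
  ∫ x in Ω, inner 𝕜 ((Real.sqrt (V x) : 𝕜) * v x) ((Real.sqrt (V x) : 𝕜) * u x)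

/-- `u ∈ L²(0, T; H¹₀(Ω))` with `∂ₜu = u' ∈ L^∞(0, T; L²(Ω))` and
`∂ₜ²u = u'' ∈ L²(0, T; H⁻¹(Ω))` is a weak solution of `∂ₜ²u - Δu + V u = f`, `u(0) = u₀`,
`∂ₜu(0) = u₁`, with homogeneous Dirichlet boundary condition. -/
def IsWeakSolution {𝕜 : Type*} [RCLike 𝕜] {n : ℕ} {Ω : Set (EuclideanSpace ℝ (Fin n))} (T : ℝ)
    (V : Lp ℝ ∞ (volume.restrict Ω)) (f : Lp (L2 𝕜 Ω) 2 (timeMeasure T))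
    (u₀ : H10 𝕜 Ω) (u₁ : L2 𝕜 Ω) (u : Lp (H10 𝕜 Ω) 2 (timeMeasure T)) : Prop :=
  ∃ (u' : Lp (L2 𝕜 Ω) ∞ (timeMeasure T)) (u'' : Lp (Hm1 𝕜 Ω) 2 (timeMeasure T)),
    IsWeakTimeDeriv T (fun t => toL2 (u t)) u' ∧
    IsWeakTimeDeriv T (fun t => toHm1 (u' t)) u'' ∧
    HasInitialValue T (fun t => toL2 (u t)) (toL2 u₀) ∧
    HasInitialValue T (fun t => toHm1 (u' t)) (toHm1 u₁) ∧
    ∀ v : Lp (H10 𝕜 Ω) 2 (timeMeasure T),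
      ∫ t in Icc 0 T, (u'' t (v t) + inner 𝕜 (grad (v t)) (grad (u t))
          + potentialForm V (toL2 (u t)) (toL2 (v t)))
        = ∫ t in Icc 0 T, inner 𝕜 (toL2 (v t)) (f t)

end WaveDirichlet

end

/-! Let `W` be `H¹₀(Ω)` with the energy inner product `(u,v) + (∇u,∇v) + (√V u,√V v)`, `Λ` its
operator, `H = L²(Ω)` and `J : W → H` the inclusion. The equation reads `u'' + Λu - u = f`, or
`(u,w)' = (w, u - Λu) + (0,f)`.

Existence is by semigroups. After subtracting the identity, the generator `(u,w) ↦ (w - u, u - Λu -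
w)` is dissipative on `W × H`, and its inverse `waveInv` is bounded and explicit: it involves only
`J` and `J*`, the latter playing the role of `Λ⁻¹`. All arguments use this bounded `B`, never an
unbounded operator or its domain. `IsDissipative.exists_semigroup` is Hille–Yosida with the Yosida
approximations `(B - ε)⁻¹` of `B⁻¹`; `IsDissipative.exists_evolution` is Duhamel's formula after
applying `B` and integrating in time; `exists_wave` reads off the components.

Uniqueness (`wave_eq_zero`) is an energy argument. Testing with `∂ₜu` is not allowed, since it has
values only in `H`, so the energy identity is applied to the smoothed solution `Λ⁻¹u`, on which the
bounded operator `JJ*` stands for `Λ⁻¹`.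

The passage to weak solutions rests on three devices: real parts of inner products reduce `𝕜` to
`ℝ`; the graph of `√V` carries the energy norm; the lemma of du Bois-Reymond turns weak derivatives
with initial values into primitives. About `Ω` one needs only that `H¹₀(Ω) → L²(Ω)` is injective
with dense range, so boundary regularity never enters. -/

namespace WaveDirichlet

/-! ### Hille–Yosida for an operator with bounded dissipative inverse. -/

section Semigroup

variable {X : Type*} [NormedAddCommGroup X] [InnerProductSpace ℝ X]

/-- A bounded operator on a real Hilbert space is dissipative if `⟪A x, x⟫ ≤ 0` for all `x`. -/
def IsDissipative (A : X →L[ℝ] X) : Prop := ∀ x, inner ℝ (A x) x ≤ 0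

theorem IsDissipative.add {A B : X →L[ℝ] X} (hA : IsDissipative A) (hB : IsDissipative B) :
    IsDissipative (A + B) := fun x => by
  rw [add_apply, inner_add_left]
  exact add_nonpos (hA x) (hB x)

theorem IsDissipative.smul {A : X →L[ℝ] X} (hA : IsDissipative A) {c : ℝ} (hc : 0 ≤ c) :
    IsDissipative (c • A) := fun x => by
  rw [smul_apply, real_inner_smul_left]
  exact mul_nonpos_of_nonneg_of_nonpos hc (hA x)


variable [CompleteSpace X]

theorem hasDerivAt_exp_smul_apply (A : X →L[ℝ] X) (x : X) (t : ℝ) :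
    HasDerivAt (fun s : ℝ => NormedSpace.exp (s • A) x) (A (NormedSpace.exp (t • A) x)) t := by
  simpa using (hasDerivAt_exp_smul_const' (𝕂 := ℝ) A t).clm_apply (hasDerivAt_const t x)

/-- Along an orbit, the derivative of the squared norm is `2⟪Ay, y⟫ ≤ 0`. -/
theorem IsDissipative.norm_exp_apply_le {A : X →L[ℝ] X} (hA : IsDissipative A) (x : X) :
    ‖NormedSpace.exp A x‖ ≤ ‖x‖ := by
  have hd : ∀ t : ℝ, HasDerivAt (fun s : ℝ => ‖NormedSpace.exp (s • A) x‖ ^ 2)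
      (2 * inner ℝ (NormedSpace.exp (t • A) x) (A (NormedSpace.exp (t • A) x))) t :=
    fun t => (hasDerivAt_exp_smul_apply A x t).norm_sq
  have hanti : Antitone fun s : ℝ => ‖NormedSpace.exp (s • A) x‖ ^ 2 := by
    refine antitone_of_deriv_nonpos (fun t => (hd t).differentiableAt) fun t => ?_
    rw [(hd t).deriv, real_inner_comm]
    linarith [hA (NormedSpace.exp (t • A) x)]
  have h := hanti (zero_le_one (α := ℝ))
  simp only [one_smul, zero_smul, NormedSpace.exp_zero, one_apply_eq_self] at h
  exact le_of_sq_le_sq h (norm_nonneg _)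

/-- By commutation, `s ↦ exp(C + sD)x` has derivative `exp(C + sD)(Dx)`, and the exponential is a
contraction. This one estimate serves to compare two approximations and also two times. -/
theorem norm_exp_add_apply_sub_le {C D : X →L[ℝ] X} (hCD : Commute C D)
    (hd : ∀ s ∈ Icc (0 : ℝ) 1, IsDissipative (C + s • D)) (x : X) :
    ‖NormedSpace.exp (C + D) x - NormedSpace.exp C x‖ ≤ ‖D x‖ := by
  let : NormedAlgebra ℚ (X →L[ℝ] X) := NormedAlgebra.restrictScalars ℚ ℝ (X →L[ℝ] X)
  have hexp : ∀ s : ℝ, NormedSpace.exp (C + s • D) =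
      NormedSpace.exp C * NormedSpace.exp (s • D) := fun s =>
    NormedSpace.exp_add_of_commute (hCD.smul_right s)
  have hder : ∀ s : ℝ, HasDerivAt (fun s : ℝ => NormedSpace.exp (C + s • D) x)
      (NormedSpace.exp (C + s • D) (D x)) s := by
    intro s
    have h1 := (hasDerivAt_exp_smul_const (𝕂 := ℝ) D s).clm_apply (hasDerivAt_const s x)
    have h2 := (NormedSpace.exp C).hasFDerivAt.comp_hasDerivAt s h1
    simp only [hexp]
    simpa [Function.comp_def] using h2
  have h := norm_image_sub_le_of_norm_deriv_le_segment_01' (C := ‖D x‖)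
    (fun s _ => (hder s).hasDerivWithinAt)
    (fun s hs => (hd s (Ico_subset_Icc_self hs)).norm_exp_apply_le (D x))
  simpa using h

/-- The inverse of `B - ε`. -/
noncomputable def shiftInv (B : X →L[ℝ] X) (ε : ℝ) : X →L[ℝ] X := Ring.inverse (B - ε • 1)

section shiftInv

variable {B : X →L[ℝ] X} (hB : IsDissipative B) {ε : ℝ} (hε : 0 < ε)
include hB hε

/-- Lax–Milgram: dissipativity gives `|⟪(B - ε)x, x⟫| ≥ ε‖x‖²`. -/
theorem IsDissipative.isUnit_sub : IsUnit (B - ε • (1 : X →L[ℝ] X)) := by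
  refine ContinuousLinearMap.isUnit_of_forall_le_norm_inner_map _ (c := Real.toNNReal ε)
    (Real.toNNReal_pos.2 hε) fun x => ?_
  have h : inner ℝ ((B - ε • (1 : X →L[ℝ] X)) x) x = inner ℝ (B x) x - ε * ‖x‖ ^ 2 := by
    simp [inner_sub_left, real_inner_smul_left]
  rw [h, Real.norm_eq_abs, abs_of_nonpos, Real.coe_toNNReal _ hε.le]
  · linarith [hB x]
  · nlinarith [hB x, sq_nonneg ‖x‖]

theorem IsDissipative.sub_shiftInv_apply (x : X) :
    B (shiftInv B ε x) = x + ε • shiftInv B ε x := by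
  have h := DFunLike.congr_fun (Ring.mul_inverse_cancel _ (hB.isUnit_sub hε)) x
  change B (shiftInv B ε x) - ε • shiftInv B ε x = x at h
  exact sub_eq_iff_eq_add.1 h

theorem IsDissipative.shiftInv_apply (x : X) :
    shiftInv B ε (B x) = x + ε • shiftInv B ε x := by
  have h := DFunLike.congr_fun (Ring.inverse_mul_cancel _ (hB.isUnit_sub hε)) x
  change shiftInv B ε (B x - ε • x) = x at h
  rw [map_sub, map_smul] at h
  exact sub_eq_iff_eq_add.1 h

theorem IsDissipative.shiftInv : IsDissipative (shiftInv B ε) := fun x => by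
  set y := WaveDirichlet.shiftInv B ε x
  have hx : x = B y - ε • y := eq_sub_of_add_eq (hB.sub_shiftInv_apply hε x).symm
  rw [hx, inner_sub_right, real_inner_smul_right, real_inner_self_eq_norm_sq, real_inner_comm]
  nlinarith [hB y, sq_nonneg ‖y‖]

theorem IsDissipative.norm_smul_shiftInv_le (x : X) : ‖ε • WaveDirichlet.shiftInv B ε x‖ ≤ ‖x‖ := by
  set y := WaveDirichlet.shiftInv B ε x
  have hx : x = B y - ε • y := eq_sub_of_add_eq (hB.sub_shiftInv_apply hε x).symm
  rw [norm_smul, Real.norm_of_nonneg hε.le]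
  have h1 : ε * ‖y‖ ^ 2 ≤ ‖x‖ * ‖y‖ := by
    have h2 : inner ℝ x y = inner ℝ (B y) y - ε * ‖y‖ ^ 2 := by
      rw [hx, inner_sub_left, real_inner_smul_left, real_inner_self_eq_norm_sq]
    have h3 := (abs_le.1 (abs_real_inner_le_norm x y)).1
    linarith [hB y]
  rcases (norm_nonneg y).eq_or_lt with h0 | h0
  · rw [← h0, mul_zero]; positivity
  · exact le_of_mul_le_mul_right (by linarith [sq ‖y‖]) h0

theorem IsDissipative.norm_shiftInv_map_le (x : X) :
    ‖WaveDirichlet.shiftInv B ε (B x)‖ ≤ 2 * ‖x‖ := by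
  rw [hB.shiftInv_apply hε]
  linarith [norm_add_le x (ε • WaveDirichlet.shiftInv B ε x), hB.norm_smul_shiftInv_le hε x]

end shiftInv

omit [CompleteSpace X] in
theorem commute_shiftInv (B : X →L[ℝ] X) (ε δ : ℝ) : Commute (shiftInv B ε) (shiftInv B δ) := by
  refine Commute.ringInverse_ringInverse ?_
  refine (Commute.sub_left ?_ ?_)
  · exact (Commute.refl B).sub_right ((Commute.one_right B).smul_right δ)
  · exact ((Commute.one_left _).smul_left ε)

/-- With `A_ε = (B - ε)⁻¹`, the identity `A_ε B = 1 + εA_ε` makes the leading terms cancel on the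
range of `B²`: `(A_ε - A_δ)B²x = εA_ε Bx - δA_δ Bx`, where `A_ε B` is bounded by `2` for every `ε`.
-/
theorem IsDissipative.norm_exp_shiftInv_sub_le {B : X →L[ℝ] X} (hB : IsDissipative B) {ε δ t : ℝ}
    (hε : 0 < ε) (hδ : 0 < δ) (ht : 0 ≤ t) (x : X) :
    ‖NormedSpace.exp (t • WaveDirichlet.shiftInv B ε) (B (B x)) -
      NormedSpace.exp (t • WaveDirichlet.shiftInv B δ) (B (B x))‖ ≤ t * (2 * (ε + δ) * ‖x‖) := by
  set A := WaveDirichlet.shiftInv B ε with hA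
  set A' := WaveDirichlet.shiftInv B δ with hA'
  have hc : Commute (t • A') (t • (A - A')) :=
    (((commute_shiftInv B δ ε).sub_right (Commute.refl _)).smul_right t).smul_left t
  have h := norm_exp_add_apply_sub_le hc (fun s hs => ?_) (B (B x))
  · rw [← smul_add, add_sub_cancel] at h
    refine h.trans ?_
    rw [smul_apply, norm_smul, Real.norm_of_nonneg ht]
    refine mul_le_mul_of_nonneg_left ?_ ht
    have e : (A - A') (B (B x)) = ε • A (B x) - δ • A' (B x) := by
      rw [sub_apply, hA, hA', hB.shiftInv_apply hε, hB.shiftInv_apply hδ]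
      abel
    rw [e]
    refine (norm_sub_le _ _).trans ?_
    rw [norm_smul, norm_smul, Real.norm_of_nonneg hε.le, Real.norm_of_nonneg hδ.le]
    nlinarith [hB.norm_shiftInv_map_le hε x, hB.norm_shiftInv_map_le hδ x]
  -- The segment joining the two generators consists of nonnegative combinations, hence stays
  -- dissipative.
  · have e : t • A' + s • t • (A - A') = (t * (1 - s)) • A' + (t * s) • A := by module
    rw [e]
    exact ((hB.shiftInv hδ).smul (mul_nonneg ht (by linarith [hs.2]))).add
      ((hB.shiftInv hε).smul (mul_nonneg ht hs.1))

theorem IsDissipative.norm_exp_shiftInv_time_sub_le {B : X →L[ℝ] X} (hB : IsDissipative B)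
    {ε s t : ℝ} (hε : 0 < ε) (hs : 0 ≤ s) (ht : 0 ≤ t) (x : X) :
    ‖NormedSpace.exp (t • WaveDirichlet.shiftInv B ε) (B x) -
      NormedSpace.exp (s • WaveDirichlet.shiftInv B ε) (B x)‖ ≤ 2 * ‖x‖ * |t - s| := by
  set A := WaveDirichlet.shiftInv B ε with hA
  have hc : Commute (s • A) ((t - s) • A) := ((Commute.refl _).smul_right _).smul_left _
  have h := norm_exp_add_apply_sub_le hc (fun r hr => ?_) (B x)
  · rw [← add_smul, add_sub_cancel] at h
    refine h.trans ?_
    rw [smul_apply, norm_smul, Real.norm_eq_abs, mul_comm]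
    exact mul_le_mul_of_nonneg_right (hB.norm_shiftInv_map_le hε x) (abs_nonneg _)
  · have e : s • A + r • (t - s) • A = (s * (1 - r) + r * t) • A := by module
    rw [e]
    exact (hB.shiftInv hε).smul (add_nonneg (mul_nonneg hs (by linarith [hr.2]))
      (mul_nonneg hr.1 ht))

omit [CompleteSpace X] in
/-- A sequence of linear contractions that converges pointwise on a dense set does so
everywhere. -/
theorem cauchySeq_of_dense {E : ℕ → X →L[ℝ] X} (hE : ∀ n x, ‖E n x‖ ≤ ‖x‖) {s : Set X}
    (hs : Dense s) (h : ∀ x ∈ s, CauchySeq fun n => E n x) (x : X) : CauchySeq fun n => E n x := by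
  rw [Metric.cauchySeq_iff']
  intro r hr
  obtain ⟨y, hy, hxy⟩ := hs.exists_dist_lt x (show 0 < r / 3 by positivity)
  obtain ⟨N, hN⟩ := Metric.cauchySeq_iff'.1 (h y hy) (r / 3) (by positivity)
  refine ⟨N, fun n hn => ?_⟩
  have h1 : ∀ k, dist (E k x) (E k y) ≤ dist x y := fun k => by
    rw [dist_eq_norm, dist_eq_norm, ← map_sub]; exact hE k _
  have := dist_triangle4 (E n x) (E n y) (E N y) (E N x)
  rw [dist_comm (E N y)] at this
  linarith [h1 n, h1 N, hN n hn]

omit [CompleteSpace X] in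
/-- Linear contractions that tend to zero pointwise on a dense set do so everywhere. -/
theorem tendsto_zero_of_dense {E : ℕ → X →L[ℝ] X} (hE : ∀ n x, ‖E n x‖ ≤ ‖x‖) {s : Set X}
    (hs : Dense s) (h : ∀ x ∈ s, Tendsto (fun n => E n x) atTop (nhds 0)) (x : X) :
    Tendsto (fun n => E n x) atTop (nhds 0) := by
  rw [Metric.tendsto_atTop]
  intro r hr
  obtain ⟨y, hy, hxy⟩ := hs.exists_dist_lt x (show 0 < r / 2 by positivity)
  obtain ⟨N, hN⟩ := Metric.tendsto_atTop.1 (h y hy) (r / 2) (by positivity)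
  refine ⟨N, fun n hn => ?_⟩
  have h1 : dist (E n x) (E n y) ≤ dist x y := by
    rw [dist_eq_norm, dist_eq_norm, ← map_sub]; exact hE n _
  linarith [dist_triangle (E n x) (E n y) 0, hN n hn]

/-- The Hille–Yosida theorem for an operator `B⁻¹` with bounded dissipative inverse `B`: it
generates a contraction semigroup `S`, characterized by `d/dt B S(t) x = S(t) x`. -/
theorem IsDissipative.exists_semigroup {B : X →L[ℝ] X} (hB : IsDissipative B)
    (hr : DenseRange B) :
    ∃ S : ℝ → X →L[ℝ] X, (∀ t x, ‖S t x‖ ≤ ‖x‖) ∧ (Continuous fun p : X × ℝ => S p.2 p.1) ∧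
      S 0 = 1 ∧ ∀ t, 0 ≤ t → ∀ x, B (S t x) = B x + ∫ s in (0 : ℝ)..t, S s x := by
  set ε : ℕ → ℝ := fun n => 1 / ((n : ℝ) + 1) with hεdef
  have hε : ∀ n, 0 < ε n := fun n => Nat.one_div_pos_of_nat
  have hε0 : Tendsto ε atTop (nhds 0) := tendsto_one_div_add_atTop_nhds_zero_nat
  set A : ℕ → X →L[ℝ] X := fun n => WaveDirichlet.shiftInv B (ε n) with hAdef
  -- Truncating at `0` gives contractions, jointly continuous in the limit, for all real times; only
  -- `t ≥ 0` matters.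
  set E : ℕ → ℝ → X →L[ℝ] X := fun n t => NormedSpace.exp (max t 0 • A n) with hEdef
  have hEle : ∀ t n x, ‖E n t x‖ ≤ ‖x‖ := fun t n x =>
    ((hB.shiftInv (hε n)).smul (le_max_right _ _)).norm_exp_apply_le x
  have hr2 : DenseRange fun x => B (B x) := hr.comp hr B.continuous
  have hcau : ∀ t x, CauchySeq fun n => E n t x := by
    intro t
    refine cauchySeq_of_dense (hEle t) hr2 ?_
    rintro _ ⟨x, rfl⟩
    have hlim : Tendsto (fun N => max t 0 * (4 * ε N * ‖x‖)) atTop (nhds 0) := by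
      simpa using ((hε0.const_mul 4).mul_const ‖x‖).const_mul (max t 0)
    refine cauchySeq_of_le_tendsto_0 _ (fun n m N hn hm => ?_) hlim
    rw [dist_eq_norm]
    refine (hB.norm_exp_shiftInv_sub_le (hε n) (hε m) (le_max_right _ _) x).trans ?_
    have := Nat.one_div_le_one_div (α := ℝ) hn
    have := Nat.one_div_le_one_div (α := ℝ) hm
    have hnm : 2 * (ε n + ε m) ≤ 4 * ε N := by simp only [hεdef]; linarith
    gcongr
  choose S₀ hS₀ using fun t x => cauchySeq_tendsto_of_complete (hcau t x)
  have hS₀le : ∀ t x, ‖S₀ t x‖ ≤ ‖x‖ := fun t x =>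
    le_of_tendsto (hS₀ t x).norm (Eventually.of_forall fun n => hEle t n x)
  let S : ℝ → X →L[ℝ] X := fun t => LinearMap.mkContinuous
    { toFun := S₀ t
      map_add' := fun x y => tendsto_nhds_unique (hS₀ t (x + y)) (by
        simpa only [map_add] using (hS₀ t x).add (hS₀ t y))
      map_smul' := fun c x => tendsto_nhds_unique (hS₀ t (c • x)) (by
        simpa only [map_smul, RingHom.id_apply] using (hS₀ t x).const_smul c) } 1
    (fun x => by rw [one_mul]; exact hS₀le t x)
  have hS : ∀ t x, Tendsto (fun n => E n t x) atTop (nhds (S t x)) := hS₀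
  have hSle : ∀ t x, ‖S t x‖ ≤ ‖x‖ := hS₀le
  -- `S t` is `1`-Lipschitz in the vector, and on the dense range of `B` it is Lipschitz in time.
  have hScont : Continuous fun p : X × ℝ => S p.2 p.1 := by
    refine continuous_prod_of_dense_continuous_lipschitzWith _ 1 hr ?_ fun t =>
      LipschitzWith.of_dist_le_mul fun x y => ?_
    · rintro _ ⟨x, rfl⟩
      refine LipschitzWith.continuous (K := Real.toNNReal (2 * ‖x‖))
        (LipschitzWith.of_dist_le_mul fun t s => ?_)
      rw [Real.coe_toNNReal _ (by positivity), dist_eq_norm]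
      refine le_of_tendsto ((hS t (B x)).sub (hS s (B x))).norm (Eventually.of_forall fun n => ?_)
      refine (hB.norm_exp_shiftInv_time_sub_le (hε n) (le_max_right _ _) (le_max_right _ _)
        x).trans ?_
      refine mul_le_mul_of_nonneg_left ?_ (by positivity)
      exact abs_max_sub_max_le_abs t s 0
    · simpa [dist_eq_norm, ← map_sub] using hSle t (x - y)
  refine ⟨S, hSle, hScont, ?_, fun t ht x => ?_⟩
  · ext x
    refine tendsto_nhds_unique (hS 0 x) ?_
    simp [hEdef]
  · have hcomm : ∀ n s, A n (E n s x) = E n s (A n x) := fun n s => by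
      have : Commute (A n) (E n s) :=
        ((Commute.refl (A n)).smul_right (max s 0)).exp_right
      exact DFunLike.congr_fun this.eq x
    -- Since `B A_ε = 1 + εA_ε`, this is the error in the integrated equation for the
    -- approximations. It is `O(ε)` on the range of `B`, and the operators `εA_ε` are contractions.
    have hsmall : Tendsto (fun n => ε n • A n x) atTop (nhds 0) := by
      refine tendsto_zero_of_dense (E := fun n => ε n • A n)
        (fun n y => hB.norm_smul_shiftInv_le (hε n) y) hr ?_ x
      rintro _ ⟨y, rfl⟩
      refine squeeze_zero_norm (fun n => ?_) (a := fun n => ε n * (2 * ‖y‖)) ?_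
      · rw [smul_apply, norm_smul, Real.norm_of_nonneg (hε n).le]
        exact mul_le_mul_of_nonneg_left (hB.norm_shiftInv_map_le (hε n) y) (hε n).le
      · simpa using hε0.mul_const (2 * ‖y‖)
    have hEcont : ∀ n y, Continuous fun s => E n s y := fun n y => by
      have : Continuous fun s : ℝ => NormedSpace.exp (s • A n) y :=
        continuous_iff_continuousAt.2 fun s => (hasDerivAt_exp_smul_apply (A n) y s).continuousAt
      exact this.comp (continuous_id.max continuous_const)
    have hint : ∀ n, B (E n t x) = B x + ∫ s in (0 : ℝ)..t, (E n s x + ε n • E n s (A n x)) := by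
      intro n
      have h1 : ∫ s in (0 : ℝ)..t, (E n s x + ε n • E n s (A n x)) = B (E n t x) - B (E n 0 x) := by
        refine intervalIntegral.integral_eq_sub_of_hasDerivAt_of_le ht
          (B.continuous.comp (hEcont n x)).continuousOn (fun s hs => ?_) ?_
        · have h2 := B.hasFDerivAt.comp_hasDerivAt s (hasDerivAt_exp_smul_apply (A n) x s)
          have h3 : E n s x + ε n • E n s (A n x) = B (A n (NormedSpace.exp (s • A n) x)) := by
            rw [hB.sub_shiftInv_apply (hε n), ← hcomm]
            simp only [hEdef, max_eq_left hs.1.le, hAdef]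
          rw [h3]
          refine h2.congr_of_eventuallyEq ?_
          filter_upwards [Ioi_mem_nhds hs.1] with r hr'
          simp only [hEdef, max_eq_left (mem_Ioi.1 hr').le, Function.comp_apply]
        · exact ((hEcont n x).add ((hEcont n (A n x)).const_smul _)).intervalIntegrable _ _
      rw [h1]
      simp [hEdef]
    refine tendsto_nhds_unique ((B.continuous.tendsto _).comp (hS t x)) ?_
    simp only [Function.comp_def, hint]
    refine Tendsto.const_add _ ?_
    refine intervalIntegral.tendsto_integral_filter_of_dominated_convergence (fun _ => 2 * ‖x‖)
      (Eventually.of_forall fun n => ?_) (Eventually.of_forall fun n => ?_) ?_ ?_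
    · exact ((hEcont n x).add ((hEcont n (A n x)).const_smul _)).aestronglyMeasurable
    · refine Eventually.of_forall fun s _ => (norm_add_le _ _).trans ?_
      rw [← map_smul]
      linarith [hEle s n x, hEle s n (ε n • A n x), hB.norm_smul_shiftInv_le (hε n) x]
    · exact intervalIntegrable_const
    · refine Eventually.of_forall fun s _ => ?_
      rw [← add_zero (S s x)]
      refine (hS s x).add (squeeze_zero_norm (fun n => ?_) (by simpa using hsmall.norm))
      rw [← map_smul]
      exact hEle s n _

end Semigroup

/-! ### Fubini for the Duhamel integral. -/

section Duhamel

variable {X : Type*} [NormedAddCommGroup X] [NormedSpace ℝ X]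

/-- Fubini's theorem for the Duhamel integral `∫₀ʳ T(r - s) F(s) ds`. -/
theorem integral_duhamel {T : ℝ → X →L[ℝ] X} (hT : Continuous fun p : X × ℝ => T p.2 p.1)
    {a M : ℝ} (ha : 0 ≤ a) (hM : ∀ τ ∈ Icc 0 a, ∀ x, ‖T τ x‖ ≤ M * ‖x‖) {F : ℝ → X}
    (hF : IntegrableOn F (Ioc 0 a)) :
    IntervalIntegrable (fun r => ∫ s in (0 : ℝ)..r, T (r - s) (F s)) volume 0 a ∧
      IntervalIntegrable (fun s => ∫ τ in (0 : ℝ)..(a - s), T τ (F s)) volume 0 a ∧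
      ∫ r in (0 : ℝ)..a, ∫ s in (0 : ℝ)..r, T (r - s) (F s) =
        ∫ s in (0 : ℝ)..a, ∫ τ in (0 : ℝ)..(a - s), T τ (F s) := by
  set μ := (volume : Measure ℝ).restrict (Ioc 0 a)
  -- Kernel on the triangle `s < r`; integrating first in `r` and substituting `τ = r - s` gives the
  -- right-hand side.
  set k : ℝ → ℝ → X := fun r s => {p : ℝ × ℝ | p.2 < p.1}.indicator
    (fun p => T (p.1 - p.2) (F p.2)) (r, s) with hk
  have hmeas : MeasurableSet {p : ℝ × ℝ | p.2 < p.1} :=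
    measurableSet_lt measurable_snd measurable_fst
  have hkint : Integrable (Function.uncurry k) (μ.prod μ) := by
    have hFs : Integrable (fun p : ℝ × ℝ => F p.2) (μ.prod μ) := hF.comp_snd μ
    refine (hFs.norm.const_mul M).mono ?_ ?_
    · refine AEStronglyMeasurable.indicator ?_ hmeas
      exact hT.comp_aestronglyMeasurable
        (hFs.aestronglyMeasurable.prodMk (continuous_fst.sub continuous_snd).aestronglyMeasurable)
    · have : ∀ᵐ p ∂μ.prod μ, p ∈ Ioc 0 a ×ˢ Ioc 0 a := by
        rw [Measure.prod_restrict]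
        exact ae_restrict_mem (measurableSet_Ioc.prod measurableSet_Ioc)
      filter_upwards [this] with p hp
      change ‖k p.1 p.2‖ ≤ _
      simp only [hk, indicator_apply, mem_ofPred_eq]
      split_ifs with h
      · refine (hM _ ⟨by linarith, by linarith [hp.1.2, hp.2.1]⟩ _).trans (le_abs_self _)
      · rw [norm_zero]; exact norm_nonneg _
  have h1 : ∀ r ∈ Ioc 0 a, ∫ s in (0 : ℝ)..r, T (r - s) (F s) = ∫ s, k r s ∂μ := by
    intro r hr
    have e : k r = (Iio r).indicator fun s => T (r - s) (F s) := by
      ext s; simp [hk, indicator_apply]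
    rw [e, integral_indicator measurableSet_Iio, Measure.restrict_restrict measurableSet_Iio,
      intervalIntegral.integral_of_le hr.1.le, integral_Ioc_eq_integral_Ioo]
    congr 2
    ext s; simp only [mem_Ioo, mem_inter_iff, mem_Iio, mem_Ioc]
    constructor
    · exact fun h => ⟨h.2, h.1, h.2.le.trans hr.2⟩
    · exact fun h => ⟨h.2.1, h.1⟩
  have h2 : ∀ s ∈ Ioc 0 a, ∫ τ in (0 : ℝ)..(a - s), T τ (F s) = ∫ r, k r s ∂μ := by
    intro s hs
    have e : (fun r => k r s) = (Ioi s).indicator fun r => T (r - s) (F s) := by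
      ext r; simp [hk, indicator_apply]
    have e' := intervalIntegral.integral_comp_sub_right (a := s) (b := a) (fun τ => T τ (F s)) s
    rw [sub_self] at e'
    rw [e, integral_indicator measurableSet_Ioi, Measure.restrict_restrict measurableSet_Ioi,
      ← e', intervalIntegral.integral_of_le hs.2]
    congr 2
    ext r; simp only [mem_inter_iff, mem_Ioi, mem_Ioc]
    constructor
    · exact fun h => ⟨h.1, hs.1.trans h.1, h.2⟩
    · exact fun h => ⟨h.1, h.2.2⟩
  refine ⟨?_, ?_, ?_⟩
  · rw [intervalIntegrable_iff_integrableOn_Ioc_of_le ha]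
    refine hkint.integral_prod_left.congr ?_
    filter_upwards [ae_restrict_mem measurableSet_Ioc] with r hr using (h1 r hr).symm
  · rw [intervalIntegrable_iff_integrableOn_Ioc_of_le ha]
    refine hkint.integral_prod_right.congr ?_
    filter_upwards [ae_restrict_mem measurableSet_Ioc] with s hs using (h2 s hs).symm
  · rw [intervalIntegral.integral_of_le ha, intervalIntegral.integral_of_le ha,
      setIntegral_congr_fun measurableSet_Ioc h1, setIntegral_congr_fun measurableSet_Ioc h2]
    exact integral_integral_swap hkint

end Duhamel

/-! ### The inhomogeneous evolution equation. -/

section Evolution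

variable {X : Type*} [NormedAddCommGroup X] [InnerProductSpace ℝ X] [CompleteSpace X]

/-- For `B` bounded and dissipative with dense range, `B⁻¹ + 1` generates a semigroup `T` with
`‖T(t)‖ ≤ eᵗ`. -/
theorem IsDissipative.exists_shifted_semigroup {B : X →L[ℝ] X} (hB : IsDissipative B)
    (hr : DenseRange B) :
    ∃ S : ℝ → X →L[ℝ] X, (∀ t x, ‖S t x‖ ≤ Real.exp t * ‖x‖) ∧
      (Continuous fun p : X × ℝ => S p.2 p.1) ∧ S 0 = 1 ∧
      ∀ t, 0 ≤ t → ∀ x, B (S t x) = B x + ∫ s in (0 : ℝ)..t, (S s x + B (S s x)) := by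
  obtain ⟨S, hS1, hS2, hS3, hS4⟩ := hB.exists_semigroup hr
  refine ⟨fun t => Real.exp t • S t, fun t x => ?_, ?_, ?_, fun t ht x => ?_⟩
  · rw [smul_apply, norm_smul, Real.norm_of_nonneg (Real.exp_pos t).le]
    exact mul_le_mul_of_nonneg_left (hS1 t x) (Real.exp_pos t).le
  · exact (Real.continuous_exp.comp continuous_snd).smul hS2
  · simp [hS3]
  · have hc : Continuous fun s => S s x := hS2.comp (Continuous.prodMk_right x)
    -- The differentiated function is `eˢ B(S(s)x)` for `s ≥ 0`; the product rule produces the extra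
    -- term of the shifted generator.
    have hd : ∀ s, HasDerivAt (fun s => Real.exp s • (B x + ∫ r in (0 : ℝ)..s, S r x))
        (Real.exp s • S s x + Real.exp s • (B x + ∫ r in (0 : ℝ)..s, S r x)) s := fun s =>
      (Real.hasDerivAt_exp s).smul
        ((intervalIntegral.integral_hasDerivAt_right (hc.intervalIntegrable _ _)
          (hc.stronglyMeasurableAtFilter _ _) hc.continuousAt).const_add (B x))
    have hG : Continuous fun s => B x + ∫ r in (0 : ℝ)..s, S r x :=
      continuous_const.add (intervalIntegral.continuous_primitive
        (fun a b => hc.intervalIntegrable a b) 0)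
    have h := intervalIntegral.integral_eq_sub_of_hasDerivAt (a := 0) (b := t)
      (fun s _ => hd s) (((Real.continuous_exp.smul hc).add
        (Real.continuous_exp.smul hG)).intervalIntegrable _ _)
    have h' : ∫ s in (0 : ℝ)..t, ((Real.exp s • S s) x + B ((Real.exp s • S s) x)) =
        ∫ s in (0 : ℝ)..t, (Real.exp s • S s x +
          Real.exp s • (B x + ∫ r in (0 : ℝ)..s, S r x)) := by
      refine intervalIntegral.integral_congr fun s hs => ?_
      rw [uIcc_of_le ht] at hs
      simp only [smul_apply, map_smul, hS4 s hs.1 x]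
    rw [h', h, smul_apply, map_smul, hS4 t ht x]
    simp

/-- The inhomogeneous evolution equation `y' = (B⁻¹ + 1) y + F`, `y(0) = x₀`, in the integrated
form that is obtained by applying `B`. -/
theorem IsDissipative.exists_evolution {B : X →L[ℝ] X} (hB : IsDissipative B)
    (hr : DenseRange B) (x₀ : X) {T : ℝ} (hT : 0 ≤ T) {F : ℝ → X}
    (hF : IntegrableOn F (Icc 0 T)) :
    ∃ (y : ℝ → X) (M : ℝ), IntegrableOn y (Icc 0 T) ∧ (∀ t ∈ Icc 0 T, ‖y t‖ ≤ M) ∧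
      ∀ t ∈ Icc 0 T, B (y t) = B x₀ + ∫ s in (0 : ℝ)..t, (y s + B (y s) + B (F s)) := by
  obtain ⟨S, hS1, hS2, hS3, hS4⟩ := hB.exists_shifted_semigroup hr
  have hbd : ∀ τ ∈ Icc 0 T, ∀ x, ‖S τ x‖ ≤ Real.exp T * ‖x‖ := fun τ hτ x =>
    (hS1 τ x).trans (mul_le_mul_of_nonneg_right (Real.exp_le_exp.2 hτ.2) (norm_nonneg _))
  set z : ℝ → X := fun r => ∫ s in (0 : ℝ)..r, S (r - s) (F s) with hz
  have hSc : ∀ x, Continuous fun s => S s x := fun x => hS2.comp (Continuous.prodMk_right x)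
  have hFt : ∀ t ∈ Icc 0 T, IntegrableOn F (Ioc 0 t) := fun t ht =>
    hF.mono_set (Ioc_subset_Icc_self.trans (Icc_subset_Icc_right ht.2))
  have hduh := fun t (ht : t ∈ Icc 0 T) => integral_duhamel hS2 ht.1
    (fun τ hτ x => hbd τ ⟨hτ.1, hτ.2.trans ht.2⟩ x) (hFt t ht)
  have hzt : IntegrableOn z (Ioc 0 T) :=
    (intervalIntegrable_iff_integrableOn_Ioc_of_le hT).1 (hduh T (right_mem_Icc.2 hT)).1
  refine ⟨fun t => S t x₀ + z t, Real.exp T * ‖x₀‖ + Real.exp T * ∫ s in Icc 0 T, ‖F s‖,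
    ?_, fun t ht => ?_, fun t ht => ?_⟩
  · rw [integrableOn_Icc_iff_integrableOn_Ioc]
    exact ((hSc x₀).integrableOn_Ioc).add hzt
  · refine (norm_add_le _ _).trans (add_le_add (hbd t ht x₀) ?_)
    rw [← integral_const_mul, hz]
    simp only
    rw [intervalIntegral.integral_of_le ht.1]
    calc ‖∫ s in Ioc 0 t, S (t - s) (F s)‖ ≤ ∫ s in Ioc 0 t, Real.exp T * ‖F s‖ := by
          refine norm_integral_le_of_norm_le ((hFt t ht).norm.const_mul _) ?_
          filter_upwards [ae_restrict_mem measurableSet_Ioc] with s hs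
          exact hbd _ ⟨by linarith [hs.2], by linarith [hs.1, ht.2]⟩ _
      _ ≤ _ := by
          refine setIntegral_mono_set (hF.norm.const_mul _)
            (Eventually.of_forall fun s => mul_nonneg (Real.exp_pos T).le (norm_nonneg _)) ?_
          exact (Ioc_subset_Icc_self.trans (Icc_subset_Icc_right ht.2)).eventuallyLE
  · obtain ⟨i1, i2, heq⟩ := hduh t ht
    have iF : IntervalIntegrable F volume 0 t :=
      (intervalIntegrable_iff_integrableOn_Ioc_of_le ht.1).2 (hFt t ht)
    have ix : IntervalIntegrable (fun s => S s x₀ + B (S s x₀)) volume 0 t :=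
      ((hSc x₀).add (B.continuous.comp (hSc x₀))).intervalIntegrable _ _
    set D : X →L[ℝ] X := 1 + B with hD
    -- The semigroup equation with initial vector `F s` at time `t - s`. Integrated in `s`, it
    -- becomes the equation for the Duhamel term.
    have hDS : ∀ s ∈ uIcc 0 t, D (∫ τ in (0 : ℝ)..(t - s), S τ (F s)) =
        B (S (t - s) (F s)) - B (F s) := by
      intro s hs
      rw [uIcc_of_le ht.1] at hs
      rw [← D.intervalIntegral_comp_comm ((hSc (F s)).intervalIntegrable _ _),
        hS4 (t - s) (by linarith [hs.2]) (F s), add_sub_cancel_left]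
      rfl
    have iBz : IntervalIntegrable (fun s => B (S (t - s) (F s)) - B (F s)) volume 0 t := by
      have h := D.integrable_comp
        ((intervalIntegrable_iff_integrableOn_Ioc_of_le ht.1).1 i2)
      rw [intervalIntegrable_iff_integrableOn_Ioc_of_le ht.1]
      refine h.congr ?_
      filter_upwards [ae_restrict_mem measurableSet_Ioc] with s hs
      exact hDS s (by rw [uIcc_of_le ht.1]; exact Ioc_subset_Icc_self hs)
    have iBF : IntervalIntegrable (fun s => B (F s)) volume 0 t :=
      (intervalIntegrable_iff_integrableOn_Ioc_of_le ht.1).2 (B.integrable_comp (hFt t ht))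
    have iSF : IntervalIntegrable (fun s => S (t - s) (F s)) volume 0 t := by
      rw [intervalIntegrable_iff_integrableOn_Ioc_of_le ht.1]
      refine ((hFt t ht).norm.const_mul (Real.exp T)).mono ?_ ?_
      · exact hS2.comp_aestronglyMeasurable ((hFt t ht).aestronglyMeasurable.prodMk
          (continuous_const.sub continuous_id).aestronglyMeasurable)
      · filter_upwards [ae_restrict_mem measurableSet_Ioc] with s hs
        exact (hbd _ ⟨by linarith [hs.2], by linarith [hs.1, ht.2]⟩ _).trans (le_abs_self _)
    have hDz : ∫ s in (0 : ℝ)..t, D (z s) = B (z t) - ∫ s in (0 : ℝ)..t, B (F s) := by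
      rw [D.intervalIntegral_comp_comm i1, heq, ← D.intervalIntegral_comp_comm i2,
        intervalIntegral.integral_congr hDS, hz]
      simp only
      rw [← B.intervalIntegral_comp_comm iSF, ← intervalIntegral.integral_sub _ iBF]
      exact (intervalIntegrable_iff_integrableOn_Ioc_of_le ht.1).2
        (B.integrable_comp ((intervalIntegrable_iff_integrableOn_Ioc_of_le ht.1).1 iSF))
    have iDz : IntervalIntegrable (fun s => D (z s)) volume 0 t :=
      (intervalIntegrable_iff_integrableOn_Ioc_of_le ht.1).2
        (D.integrable_comp ((intervalIntegrable_iff_integrableOn_Ioc_of_le ht.1).1 i1))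
    have e : ∀ s, S s x₀ + z s + B (S s x₀ + z s) + B (F s) =
        (S s x₀ + B (S s x₀)) + D (z s) + B (F s) := fun s => by
      have : D (z s) = z s + B (z s) := rfl
      rw [this, map_add]; abel
    simp only [e]
    rw [intervalIntegral.integral_add (ix.add iDz) iBF, intervalIntegral.integral_add ix iDz, hDz,
      map_add, hS4 t ht.1 x₀]
    abel

end Evolution

theorem denseRange_of_forall_inner_eq_zero {𝕜 E F : Type*} [RCLike 𝕜] [NormedAddCommGroup E]
    [NormedSpace 𝕜 E] [NormedAddCommGroup F] [InnerProductSpace 𝕜 F] [CompleteSpace F]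
    (L : E →L[𝕜] F) (h : ∀ y, (∀ x, inner 𝕜 (L x) y = 0) → y = 0) : DenseRange L := by
  change Dense (Set.range L)
  rw [show Set.range L = (LinearMap.range (L : E →ₗ[𝕜] F) : Set F) from
    (LinearMap.coe_range _).symm, Submodule.dense_iff_topologicalClosure_eq_top,
    Submodule.topologicalClosure_eq_top_iff, Submodule.eq_bot_iff]
  exact fun y hy => h y fun x => (Submodule.mem_orthogonal _ _).1 hy _ ⟨x, rfl⟩

theorem _root_.IntervalIntegrable.clm_apply {E F : Type*} [NormedAddCommGroup E]
    [NormedSpace ℝ E] [NormedAddCommGroup F] [NormedSpace ℝ F] {μ : Measure ℝ} {a b : ℝ}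
    {y : ℝ → E} (h : IntervalIntegrable y μ a b) (L : E →L[ℝ] F) :
    IntervalIntegrable (fun s => L (y s)) μ a b :=
  ⟨L.integrable_comp h.1, L.integrable_comp h.2⟩

/-! ### Existence for the abstract wave equation. -/

section Wave

open ContinuousLinearMap (adjoint)

variable {W H : Type*} [NormedAddCommGroup W] [InnerProductSpace ℝ W] [CompleteSpace W]
  [NormedAddCommGroup H] [InnerProductSpace ℝ H] [CompleteSpace H]

/-- The first component of the bounded operator `waveInv`. -/
noncomputable def waveInvFst (J : W →L[ℝ] H) : WithLp 2 (W × H) →L[ℝ] W :=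
  -(adjoint J).comp (WithLp.sndL 2 ℝ W H + J.comp (WithLp.fstL 2 ℝ W H))

/-- The inverse of the operator `(u, w) ↦ (w - u, J u - Λ u - w)` on `W × H`, where `Λ` is the
operator associated with the inner product of `W`. -/
noncomputable def waveInv (J : W →L[ℝ] H) : WithLp 2 (W × H) →L[ℝ] WithLp 2 (W × H) :=
  ((WithLp.prodContinuousLinearEquiv 2 ℝ W H).symm : (W × H) →L[ℝ] WithLp 2 (W × H)).comp
    ((waveInvFst J).prod (J.comp (WithLp.fstL 2 ℝ W H + waveInvFst J)))

theorem waveInvFst_apply (J : W →L[ℝ] H) (x : WithLp 2 (W × H)) :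
    waveInvFst J x = -adjoint J (x.snd + J x.fst) := rfl

theorem inner_waveInvFst (J : W →L[ℝ] H) (x : WithLp 2 (W × H)) (v : W) :
    inner ℝ (waveInvFst J x) v = -inner ℝ (x.snd + J x.fst) (J v) := by
  rw [waveInvFst_apply, inner_neg_left, ContinuousLinearMap.adjoint_inner_left]

/-- For `x = (a, b)` and `p = -J*(b + Ja)` the quadratic form collapses to `-‖p‖² - ‖Ja‖² - ⟪Jp,
Ja⟫`, which is nonpositive because `‖Jp‖ ≤ ‖p‖`. -/
theorem isDissipative_waveInv {J : W →L[ℝ] H} (hJ : ∀ v, ‖J v‖ ≤ ‖v‖) :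
    IsDissipative (waveInv J) := fun x => by
  set p := waveInvFst J x with hp
  set c := x.snd + J x.fst with hc
  have h1 : inner ℝ p x.fst = -inner ℝ c (J x.fst) := inner_waveInvFst J x _
  have h2 : ‖p‖ ^ 2 = -inner ℝ c (J p) := by
    rw [← real_inner_self_eq_norm_sq]; exact inner_waveInvFst J x _
  have h3 : x.snd = c - J x.fst := eq_sub_of_add_eq rfl
  rw [WithLp.prod_inner_apply]
  change inner ℝ p x.fst + inner ℝ (J (x.fst + p)) x.snd ≤ 0
  clear_value c p
  have h5 := real_inner_comm c (J x.fst)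
  have h6 := real_inner_comm c (J p)
  have h7 := real_inner_self_eq_norm_sq (J x.fst)
  rw [h1, h3, map_add, inner_add_left, inner_sub_right, inner_sub_right]
  have h4 := (abs_le.1 (abs_real_inner_le_norm (J p) (J x.fst))).1
  nlinarith [hJ p, norm_nonneg (J p), norm_nonneg (J x.fst), norm_nonneg p,
    sq_nonneg (‖p‖ - ‖J x.fst‖)]

/-- Vectors `(a, c - Ja)` decouple the parameters: for `y` orthogonal to the range, `c = 0` puts
`y.snd` orthogonal to the range of `J`, and then `c = J y.fst` gives `J y.fst = 0`. -/
theorem denseRange_waveInv {J : W →L[ℝ] H} (hinj : Function.Injective J) (hd : DenseRange J) :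
    DenseRange (waveInv J) := by
  refine denseRange_of_forall_inner_eq_zero _ fun y hy => ?_
  have key : ∀ a c, -inner ℝ c (J y.fst) + (inner ℝ (J a) y.snd -
      inner ℝ c (J (adjoint J y.snd))) = 0 := by
    intro a c
    have h := hy (WithLp.toLp 2 (a, c - J a))
    rw [WithLp.prod_inner_apply] at h
    have e : waveInvFst J (WithLp.toLp 2 (a, c - J a)) = -adjoint J c := by
      rw [waveInvFst_apply, WithLp.toLp_fst, WithLp.toLp_snd, sub_add_cancel]
    change inner ℝ (waveInvFst J _) y.fst + inner ℝ (J (a + waveInvFst J _)) y.snd = 0 at h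
    have e' : inner ℝ (J (adjoint J c)) y.snd = inner ℝ c (J (adjoint J y.snd)) := by
      rw [← ContinuousLinearMap.adjoint_inner_right, ContinuousLinearMap.adjoint_inner_left]
    rw [e, inner_neg_left, ContinuousLinearMap.adjoint_inner_left, map_add, inner_add_left,
      map_neg, inner_neg_left, e'] at h
    linarith
  have h2 : y.snd = 0 := by
    refine hd.eq_zero_of_inner_left ℝ fun a => ?_
    have := key a 0
    simpa [real_inner_comm] using this
  have h1 : y.fst = 0 := by
    apply hinj
    rw [map_zero, ← inner_self_eq_zero (𝕜 := ℝ)]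
    have := key 0 (J y.fst)
    simpa [h2] using this
  exact WithLp.ofLp_injective 2 (Prod.ext h1 h2)

/-- Existence for the abstract wave equation `u'' + Λ u - u = f`, where `Λ` is the operator
associated with the inner product of `W`, in integrated form. -/
theorem exists_wave {J : W →L[ℝ] H} (hJ : ∀ v, ‖J v‖ ≤ ‖v‖) (hinj : Function.Injective J)
    (hd : DenseRange J) (u₀ : W) (u₁ : H) {T : ℝ} (hT : 0 ≤ T) {f : ℝ → H}
    (hf : IntegrableOn f (Icc 0 T)) :
    ∃ (u : ℝ → W) (w : ℝ → H) (M : ℝ), IntegrableOn u (Icc 0 T) ∧ IntegrableOn w (Icc 0 T) ∧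
      (∀ t ∈ Icc 0 T, ‖u t‖ ≤ M ∧ ‖w t‖ ≤ M) ∧
      (∀ t ∈ Icc 0 T, J (u t) = J u₀ + ∫ s in (0 : ℝ)..t, w s) ∧
      ∀ t ∈ Icc 0 T, ∀ v, inner ℝ (w t) (J v) = inner ℝ u₁ (J v) +
        ∫ s in (0 : ℝ)..t, (inner ℝ (f s) (J v) + inner ℝ (J (u s)) (J v) - inner ℝ (u s) v) := by
  set inr : H →L[ℝ] WithLp 2 (W × H) :=
    ((WithLp.prodContinuousLinearEquiv 2 ℝ W H).symm : (W × H) →L[ℝ] WithLp 2 (W × H)).comp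
      (ContinuousLinearMap.inr ℝ W H) with hinr
  obtain ⟨y, M, hy, hM, hB⟩ := (isDissipative_waveInv hJ).exists_evolution
    (denseRange_waveInv hinj hd) (WithLp.toLp 2 (u₀, u₁)) hT (inr.integrable_comp hf)
  set P := waveInvFst J with hP
  set fstL := WithLp.fstL 2 ℝ W H
  set sndL := WithLp.sndL 2 ℝ W H
  have hsub : ∀ t ∈ Icc 0 T, Ioc 0 t ⊆ Icc 0 T := fun t ht =>
    Ioc_subset_Icc_self.trans (Icc_subset_Icc_right ht.2)
  have iy : ∀ t ∈ Icc 0 T, IntervalIntegrable y volume 0 t := fun t ht =>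
    (intervalIntegrable_iff_integrableOn_Ioc_of_le ht.1).2 (hy.mono_set (hsub t ht))
  have ifi : ∀ t ∈ Icc 0 T, IntervalIntegrable f volume 0 t := fun t ht =>
    (intervalIntegrable_iff_integrableOn_Ioc_of_le ht.1).2 (hf.mono_set (hsub t ht))
  have itot : ∀ t ∈ Icc 0 T, IntervalIntegrable
      (fun s => y s + waveInv J (y s) + waveInv J (inr (f s))) volume 0 t := fun t ht =>
    ((iy t ht).add ((iy t ht).clm_apply (waveInv J))).add
      ((ifi t ht).clm_apply ((waveInv J).comp inr))
  have hPinr : ∀ h, P (inr h) = -adjoint J h := fun h => by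
    rw [hP, waveInvFst_apply]
    change -adjoint J (h + J 0) = _
    rw [map_zero, add_zero]
  have E1 : ∀ t ∈ Icc 0 T, P (y t) = P (WithLp.toLp 2 (u₀, u₁)) +
      ∫ s in (0 : ℝ)..t, ((y s).fst + P (y s) - adjoint J (f s)) := by
    intro t ht
    have h := congrArg fstL (hB t ht)
    rw [map_add, ← fstL.intervalIntegral_comp_comm (itot t ht)] at h
    refine h.trans (congrArg₂ _ rfl (intervalIntegral.integral_congr fun s _ => ?_))
    change (y s).fst + P (y s) + P (inr (f s)) = _
    rw [hPinr, ← sub_eq_add_neg]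
  have i1 : ∀ t ∈ Icc 0 T, IntervalIntegrable
      (fun s => (y s).fst + P (y s) - adjoint J (f s)) volume 0 t := fun t ht =>
    (((iy t ht).clm_apply fstL).add ((iy t ht).clm_apply P)).sub ((ifi t ht).clm_apply (adjoint J))
  have iw : ∀ t ∈ Icc 0 T, IntervalIntegrable (fun s => (y s).snd) volume 0 t := fun t ht =>
    (iy t ht).clm_apply sndL
  -- Second component of the evolution equation minus `J` applied to the first; the source cancels.
  have E2 : ∀ t ∈ Icc 0 T, J (y t).fst = J u₀ + ∫ s in (0 : ℝ)..t, (y s).snd := by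
    intro t ht
    have h := congrArg sndL (hB t ht)
    rw [map_add, ← sndL.intervalIntegral_comp_comm (itot t ht)] at h
    have h' := congrArg J (E1 t ht)
    rw [map_add, ← J.intervalIntegral_comp_comm (i1 t ht)] at h'
    change J ((y t).fst + P (y t)) = J (u₀ + P (WithLp.toLp 2 (u₀, u₁))) +
      ∫ s in (0 : ℝ)..t, ((y s).snd + J ((y s).fst + P (y s)) + J (0 + P (inr (f s)))) at h
    have e : ∫ s in (0 : ℝ)..t, ((y s).snd + J ((y s).fst + P (y s)) + J (0 + P (inr (f s)))) =
        (∫ s in (0 : ℝ)..t, (y s).snd) +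
          ∫ s in (0 : ℝ)..t, J ((y s).fst + P (y s) - adjoint J (f s)) := by
      rw [← intervalIntegral.integral_add (iw t ht)]
      · refine intervalIntegral.integral_congr fun s _ => ?_
        simp only [hPinr, zero_add, map_add, map_sub, map_neg]
        abel
      · exact (((iy t ht).clm_apply (J.comp fstL)).add ((iy t ht).clm_apply (J.comp P))).sub
          ((ifi t ht).clm_apply (J.comp (adjoint J))) |>.congr fun s _ => by simp [fstL]
    rw [e, map_add, map_add, h'] at h
    have h2 := eq_sub_of_add_eq h
    rw [h2]; abel
  refine ⟨fun t => (y t).fst, fun t => (y t).snd, M, fstL.integrable_comp hy,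
    sndL.integrable_comp hy, fun t ht => ⟨?_, ?_⟩, E2, fun t ht v => ?_⟩
  · exact (WithLp.norm_fst_le _ (y t)).trans (hM t ht)
  · exact (WithLp.norm_snd_le _ (y t)).trans (hM t ht)
  -- The first component paired with `v` carries `-⟪w + Ju, Jv⟫`; the position equation paired with
  -- `Jv` eliminates `⟪Ju, Jv⟫` at time `t` and leaves the velocity equation.
  · have h1 := congrArg (innerSL ℝ v) (E1 t ht)
    rw [map_add, ← (innerSL ℝ v).intervalIntegral_comp_comm (i1 t ht)] at h1
    have h2 := congrArg (innerSL ℝ (J v)) (E2 t ht)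
    rw [map_add, ← (innerSL ℝ (J v)).intervalIntegral_comp_comm (iw t ht)] at h2
    simp only [innerSL_apply_apply, fun z => real_inner_comm z v,
      fun z => real_inner_comm z (J v)] at h1 h2
    rw [inner_waveInvFst, inner_waveInvFst, inner_add_left, inner_add_left] at h1
    have e : ∫ s in (0 : ℝ)..t, inner ℝ ((y s).fst + P (y s) - adjoint J (f s)) v =
        -(∫ s in (0 : ℝ)..t, (inner ℝ (f s) (J v) + inner ℝ (J (y s).fst) (J v) -
          inner ℝ (y s).fst v)) - ∫ s in (0 : ℝ)..t, inner ℝ (y s).snd (J v) := by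
      rw [← intervalIntegral.integral_neg, ← intervalIntegral.integral_sub]
      · refine intervalIntegral.integral_congr fun s _ => ?_
        simp only [inner_sub_left, inner_add_left, hP, inner_waveInvFst,
          ContinuousLinearMap.adjoint_inner_left]
        ring
      · refine IntervalIntegrable.neg ?_
        refine ((((ifi t ht).clm_apply (innerSL ℝ (J v))).add
          ((iy t ht).clm_apply ((innerSL ℝ (J v)).comp (J.comp fstL)))).sub
            ((iy t ht).clm_apply ((innerSL ℝ v).comp fstL))).congr fun s _ => ?_
        simp [real_inner_comm, fstL]
      · exact ((iy t ht).clm_apply ((innerSL ℝ (J v)).comp sndL)).congr fun s _ => by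
          simp [real_inner_comm, sndL]
    rw [e] at h1
    simp only [WithLp.toLp_fst, WithLp.toLp_snd] at h1
    linarith

end Wave

/-! ### Weak time derivatives and primitives. -/

section Time

variable {E : Type*} [NormedAddCommGroup E] [NormedSpace ℝ E] {T : ℝ}

theorem integrableOn_smul_of_continuous {w : ℝ → E} (hw : IntegrableOn w (Icc 0 T)) {φ : ℝ → ℝ}
    (hφ : Continuous φ) : IntegrableOn (fun t => φ t • w t) (Icc 0 T) :=
  hw.continuousOn_smul hφ.continuousOn isCompact_Icc

theorem continuousOn_primitive_Icc {g : ℝ → E} (hT : 0 ≤ T) (hg : IntegrableOn g (Icc 0 T))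
    (x : E) :
    ContinuousOn (fun t => x + ∫ s in (0 : ℝ)..t, g s) (Icc 0 T) := by
  have h := intervalIntegral.continuousOn_primitive_interval (a := (0 : ℝ)) (b := T)
    (by rwa [uIcc_of_le hT])
  rw [uIcc_of_le hT] at h
  exact continuousOn_const.add h

theorem hasInitialValue_of_integral {w g : ℝ → E} (hT : 0 ≤ T) (hg : IntegrableOn g (Icc 0 T))
    {x : E} (hw : ∀ t ∈ Icc 0 T, w t = x + ∫ s in (0 : ℝ)..t, g s) : HasInitialValue T w x := by
  refine ⟨_, continuousOn_primitive_Icc hT hg x, ?_, by simp⟩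
  filter_upwards [ae_restrict_mem measurableSet_Icc] with t ht using (hw t ht).symm

/-- Integration by parts for a primitive. -/
theorem isWeakTimeDeriv_primitive [CompleteSpace E] {g : ℝ → E} (hT : 0 ≤ T)
    (hg : IntegrableOn g (Icc 0 T)) (x : E) :
    IsWeakTimeDeriv T (fun t => x + ∫ s in (0 : ℝ)..t, g s) g := by
  intro φ hφ hφc hφs
  have hd : Continuous (deriv φ) := hφ.continuous_deriv (by simp)
  have hφ0 : φ 0 = 0 := image_eq_zero_of_notMem_tsupport fun h => lt_irrefl _ (hφs h).1
  have hφT : φ T = 0 := image_eq_zero_of_notMem_tsupport fun h => lt_irrefl _ (hφs h).2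
  have hftc : ∀ a b, ∫ t in a..b, deriv φ t = φ b - φ a := fun a b =>
    intervalIntegral.integral_deriv_eq_sub (fun t _ => hφ.differentiable (by simp) t)
      (hd.intervalIntegrable _ _)
  set μ := (volume : Measure ℝ).restrict (Ioc 0 T)
  -- Fubini on the triangle `s ≤ r`, with `∫ₛᵀ φ' = -φ(s)`.
  set k : ℝ → ℝ → E := fun r s => {p : ℝ × ℝ | p.2 ≤ p.1}.indicator
    (fun p => deriv φ p.1 • g p.2) (r, s) with hk
  have hmeas : MeasurableSet {p : ℝ × ℝ | p.2 ≤ p.1} :=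
    measurableSet_le measurable_snd measurable_fst
  have hg' : IntegrableOn g (Ioc 0 T) := hg.mono_set Ioc_subset_Icc_self
  have hkint : Integrable (Function.uncurry k) (μ.prod μ) :=
    (Integrable.smul_prod (hd.integrableOn_Ioc) hg').indicator hmeas
  have h1 : ∀ r ∈ Ioc 0 T, deriv φ r • ∫ s in (0 : ℝ)..r, g s = ∫ s, k r s ∂μ := by
    intro r hr
    have e : k r = (Iic r).indicator fun s => deriv φ r • g s := by
      ext s; simp [hk, indicator_apply]
    rw [e, integral_indicator measurableSet_Iic, Measure.restrict_restrict measurableSet_Iic,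
      intervalIntegral.integral_of_le hr.1.le, ← integral_smul]
    congr 2
    ext s; simp only [mem_inter_iff, mem_Iic, mem_Ioc]
    exact ⟨fun h => ⟨h.2, h.1, h.2.trans hr.2⟩, fun h => ⟨h.2.1, h.1⟩⟩
  have h2 : ∀ s ∈ Ioc 0 T, -(φ s • g s) = ∫ r, k r s ∂μ := by
    intro s hs
    have e : (fun r => k r s) = (Ici s).indicator fun r => deriv φ r • g s := by
      ext r; simp [hk, indicator_apply]
    rw [e, integral_indicator measurableSet_Ici, Measure.restrict_restrict measurableSet_Ici]
    have e2 : Ici s ∩ Ioc 0 T = Icc s T := by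
      ext r; simp only [mem_inter_iff, mem_Ici, mem_Ioc, mem_Icc]
      exact ⟨fun h => ⟨h.1, h.2.2⟩, fun h => ⟨h.1, hs.1.trans_le h.1, h.2⟩⟩
    rw [e2, integral_smul_const, integral_Icc_eq_integral_Ioc,
      ← intervalIntegral.integral_of_le hs.2, hftc, hφT, zero_sub, neg_smul]
  have iG : IntegrableOn (fun r => deriv φ r • ∫ s in (0 : ℝ)..r, g s) (Ioc 0 T) :=
    hkint.integral_prod_left.congr (by
      filter_upwards [ae_restrict_mem measurableSet_Ioc] with r hr using (h1 r hr).symm)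
  have ix : IntegrableOn (fun r => deriv φ r • x) (Ioc 0 T) :=
    (hd.smul continuous_const).integrableOn_Ioc
  rw [integral_Icc_eq_integral_Ioc, integral_Icc_eq_integral_Ioc]
  simp only [smul_add]
  rw [integral_add ix iG, integral_smul_const, ← intervalIntegral.integral_of_le hT, hftc, hφ0, hφT,
    sub_self, zero_smul, zero_add, ← integral_neg, setIntegral_congr_fun measurableSet_Ioc h1,
    setIntegral_congr_fun measurableSet_Ioc h2]
  exact integral_integral_swap hkint

theorem IsWeakTimeDeriv.congr_left {w w' g : ℝ → E} (h : IsWeakTimeDeriv T w g)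
    (hw : ∀ t ∈ Icc 0 T, w' t = w t) : IsWeakTimeDeriv T w' g := by
  intro φ h1 h2 h3
  rw [← h φ h1 h2 h3]
  exact setIntegral_congr_fun measurableSet_Icc fun t ht => by simp only [hw t ht]

/-- A test function on `(0, T)` with integral zero is the derivative of a test function. -/
theorem exists_testFunction_deriv_eq {h : ℝ → ℝ} (hs : ContDiff ℝ ∞ h) (hc : HasCompactSupport h)
    (hsub : tsupport h ⊆ Ioo 0 T) (h0 : ∫ t, h t = 0) :
    ∃ χ : ℝ → ℝ, ContDiff ℝ ∞ χ ∧ HasCompactSupport χ ∧ tsupport χ ⊆ Ioo 0 T ∧ deriv χ = h := by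
  rcases (tsupport h).eq_empty_or_nonempty with he | hne
  · have : h = 0 := tsupport_eq_empty_iff.1 he
    exact ⟨0, contDiff_const, HasCompactSupport.zero, by simp, by rw [this]; simp⟩
  obtain ⟨a, ha, hal⟩ := IsCompact.exists_isLeast hc hne
  obtain ⟨b, hb, hbl⟩ := IsCompact.exists_isGreatest hc hne
  have hz : ∀ t, t ∉ Icc a b → h t = 0 := fun t ht =>
    image_eq_zero_of_notMem_tsupport fun h' => ht ⟨hal h', hbl h'⟩
  have hd : ∀ t, HasDerivAt (fun t => ∫ s in (0 : ℝ)..t, h s) (h t) t := fun t =>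
    intervalIntegral.integral_hasDerivAt_right (hs.continuous.intervalIntegrable _ _)
      (hs.continuous.stronglyMeasurableAtFilter _ _) hs.continuous.continuousAt
  have hderiv : deriv (fun t => ∫ s in (0 : ℝ)..t, h s) = h := funext fun t => (hd t).deriv
  -- The primitive vanishes left of `a` because `h` does there, and right of `b` because the total
  -- integral is zero.
  have hsupp : Function.support (fun t => ∫ s in (0 : ℝ)..t, h s) ⊆ Icc a b := by
    intro t ht
    by_contra hn
    apply ht
    rcases lt_or_ge t a with hta | hta
    · refine intervalIntegral.integral_zero_ae (Eventually.of_forall fun s hs => hz s fun hs' => ?_)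
      have := (hsub ha).1
      rcases mem_uIoc.1 hs with h' | h' <;> linarith [hs'.1, h'.1, h'.2]
    · have htb : b < t := not_le.1 fun h' => hn ⟨hta, h'⟩
      change ∫ s in (0 : ℝ)..t, h s = 0
      rw [intervalIntegral.integral_eq_integral_of_support_subset, h0]
      intro s hs
      have : s ∈ Icc a b := by_contra fun h' => hs (hz s h')
      exact ⟨(hsub ha).1.trans_le this.1, this.2.trans htb.le⟩
  have hts : tsupport (fun t => ∫ s in (0 : ℝ)..t, h s) ⊆ Icc a b :=
    closure_minimal hsupp isClosed_Icc
  refine ⟨_, ?_, isCompact_Icc.of_isClosed_subset (isClosed_tsupport _) hts, fun t ht => ?_, hderiv⟩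
  · exact contDiff_infty_iff_deriv.2 ⟨fun t => (hd t).differentiableAt, by rwa [hderiv]⟩
  · exact ⟨(hsub ha).1.trans_le (hts ht).1, (hts ht).2.trans_lt (hsub hb).2⟩

/-- The lemma of du Bois-Reymond. -/
theorem IsWeakTimeDeriv.ae_eq_const [CompleteSpace E] {w : ℝ → E} (hT : 0 < T)
    (hw : IntegrableOn w (Icc 0 T)) (h : IsWeakTimeDeriv T w 0) :
    ∃ k, w =ᵐ[timeMeasure T] fun _ => k := by
  -- A normalized bump `ρ` supported in `(0, T)`. Each `ψ - (∫ψ)ρ` has integral zero, hence is the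
  -- derivative of a test function; this identifies the constant as `∫ρw`.
  let b : ContDiffBump (T / 2) := ⟨T / 8, T / 4, by linarith, by linarith⟩
  set ρ : ℝ → ℝ := b.normed volume
  have hρs : ContDiff ℝ ∞ ρ := b.contDiff_normed
  have hρc : HasCompactSupport ρ := b.hasCompactSupport_normed
  have hρt : tsupport ρ ⊆ Ioo 0 T := by
    rw [b.tsupport_normed_eq, Real.closedBall_eq_Icc]
    intro t ht
    have h1 : T / 2 - T / 4 ≤ t := ht.1
    have h2 : t ≤ T / 2 + T / 4 := ht.2
    exact ⟨by linarith, by linarith⟩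
  have hρ1 : ∫ t, ρ t = 1 := b.integral_normed
  set k := ∫ t in Icc 0 T, ρ t • w t
  refine ⟨k, ?_⟩
  have hint : ∀ ψ : ℝ → ℝ, tsupport ψ ⊆ Ioo 0 T → ∫ t in Icc 0 T, ψ t = ∫ t, ψ t := fun ψ hψ =>
    setIntegral_eq_integral_of_forall_compl_eq_zero fun t ht =>
      image_eq_zero_of_notMem_tsupport fun h' => ht (Ioo_subset_Icc_self (hψ h'))
  have hmain : ∀ᵐ t, t ∈ Ioo 0 T → w t - k = 0 := by
    refine isOpen_Ioo.ae_eq_zero_of_integral_contDiff_smul_eq_zero ?_ fun ψ hψs hψc hψt => ?_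
    · exact ((hw.mono_set Ioo_subset_Icc_self).sub
        (integrableOn_const (by simp))).locallyIntegrableOn
    set c := ∫ t, ψ t
    set h' : ℝ → ℝ := fun t => ψ t - c * ρ t with hh'
    have hs' : ContDiff ℝ ∞ h' := hψs.sub (contDiff_const.mul hρs)
    have ht' : tsupport h' ⊆ tsupport ψ ∪ tsupport ρ := by
      refine closure_minimal (fun t ht => ?_)
        ((isClosed_tsupport ψ).union (isClosed_tsupport ρ))
      by_contra hn
      rw [mem_union, not_or] at hn
      apply ht
      simp only [hh', image_eq_zero_of_notMem_tsupport hn.1,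
        image_eq_zero_of_notMem_tsupport hn.2, mul_zero, sub_zero]
    have hc' : HasCompactSupport h' :=
      (hψc.union hρc).of_isClosed_subset (isClosed_tsupport _) ht'
    have h0' : ∫ t, h' t = 0 := by
      rw [integral_sub (hψs.continuous.integrable_of_hasCompactSupport hψc)
        ((hρs.continuous.integrable_of_hasCompactSupport hρc).const_mul c),
        integral_const_mul, hρ1, mul_one, sub_self]
    obtain ⟨χ, hχs, hχc, hχt, hχ⟩ := exists_testFunction_deriv_eq hs' hc'
      (ht'.trans (union_subset hψt hρt)) h0'
    have h1 := h χ hχs hχc hχt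
    simp only [hχ, hh', Pi.zero_apply, smul_zero, integral_zero, neg_zero, sub_smul, mul_smul] at h1
    have i2 : IntegrableOn (fun t => c • ρ t • w t) (Icc 0 T) :=
      (integrableOn_smul_of_continuous hw hρs.continuous).smul c
    rw [integral_sub (integrableOn_smul_of_continuous hw hψs.continuous) i2, integral_smul] at h1
    rw [← setIntegral_eq_integral_of_forall_compl_eq_zero (s := Icc 0 T) fun t ht => by
      rw [image_eq_zero_of_notMem_tsupport fun h' => ht (Ioo_subset_Icc_self (hψt h')), zero_smul]]
    simp only [smul_sub]
    rw [integral_sub (integrableOn_smul_of_continuous hw hψs.continuous)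
      (hψs.continuous.integrableOn_Icc.smul_const k), integral_smul_const, hint ψ hψt]
    exact h1
  rw [EventuallyEq, timeMeasure, ← Measure.restrict_congr_set Ioo_ae_eq_Icc,
    ae_restrict_iff' measurableSet_Ioo]
  filter_upwards [hmain] with t ht hI using sub_eq_zero.1 (ht hI)

/-- A function with an initial value is the primitive of its weak derivative. -/
theorem IsWeakTimeDeriv.ae_eq_primitive [CompleteSpace E] {w g : ℝ → E} {x : E} (hT : 0 < T)
    (hw : IntegrableOn w (Icc 0 T)) (hg : IntegrableOn g (Icc 0 T)) (h : IsWeakTimeDeriv T w g)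
    (h0 : HasInitialValue T w x) :
    w =ᵐ[timeMeasure T] fun t => x + ∫ s in (0 : ℝ)..t, g s := by
  have hG := continuousOn_primitive_Icc hT.le hg x
  have hGi : IntegrableOn (fun t => x + ∫ s in (0 : ℝ)..t, g s) (Icc 0 T) := hG.integrableOn_Icc
  obtain ⟨k, hk⟩ := IsWeakTimeDeriv.ae_eq_const hT (hw.sub hGi) (fun φ h1 h2 h3 => by
    have hd : Continuous (deriv φ) := h1.continuous_deriv (by simp)
    simp only [Pi.sub_apply, smul_sub]
    rw [integral_sub (integrableOn_smul_of_continuous hw hd)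
      (integrableOn_smul_of_continuous hGi hd), h φ h1 h2 h3,
      isWeakTimeDeriv_primitive hT.le hg x φ h1 h2 h3]
    simp)
  obtain ⟨c, hc, hcw, hc0⟩ := h0
  -- Two continuous functions equal almost everywhere on `[0, T]` agree at `0`, which forces `k =
  -- 0`.
  have hEq : EqOn c (fun t => k + (x + ∫ s in (0 : ℝ)..t, g s)) (Icc 0 T) := by
    refine Measure.eqOn_Icc_of_ae_eq volume hT.ne ?_ hc (continuousOn_const.add hG)
    filter_upwards [hk, hcw] with t h1 h2
    rw [h2, ← h1]; simp
  have hk0 : k = 0 := by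
    have := hEq (left_mem_Icc.2 hT.le)
    simpa [hc0] using this
  filter_upwards [hk] with t ht
  rw [hk0] at ht
  exact sub_eq_zero.1 ht

end Time

/-! ### Uniqueness by a smoothed energy identity. -/

section Uniqueness

open ContinuousLinearMap (adjoint)

variable {W H : Type*} [NormedAddCommGroup W] [InnerProductSpace ℝ W] [CompleteSpace W]
  [NormedAddCommGroup H] [InnerProductSpace ℝ H] [CompleteSpace H]

theorem injective_adjoint_of_denseRange {J : W →L[ℝ] H} (hd : DenseRange J) {b : H}
    (hb : adjoint J b = 0) : b = 0 := by
  refine hd.eq_zero_of_inner_left ℝ fun v => ?_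
  rw [← ContinuousLinearMap.adjoint_inner_left, hb, inner_zero_left]

/-- The homogeneous abstract wave equation `u'' + Λ u - u = 0` has only the trivial weak
solution. -/
theorem wave_eq_zero {J : W →L[ℝ] H} (hJ : ∀ v, ‖J v‖ ≤ ‖v‖) (hinj : Function.Injective J)
    (hd : DenseRange J) {T : ℝ} {u : ℝ → W} {w : ℝ → H}
    (hw : IntegrableOn w (Icc 0 T))
    (h1 : (fun t => J (u t)) =ᵐ[timeMeasure T] fun t => ∫ s in (0 : ℝ)..t, w s)
    (h2 : ∀ v, (fun t => inner ℝ (w t) (J v)) =ᵐ[timeMeasure T]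
      fun t => ∫ s in (0 : ℝ)..t, (inner ℝ (J (u s)) (J v) - inner ℝ (u s) v)) :
    u =ᵐ[timeMeasure T] 0 := by
  set S : H →L[ℝ] H := J.comp (adjoint J) with hS
  have hSinner : ∀ a b, inner ℝ (S a) b = inner ℝ (adjoint J a) (adjoint J b) := fun a b => by
    rw [hS, ContinuousLinearMap.comp_apply, ← ContinuousLinearMap.adjoint_inner_right]
  have hSsymm : ∀ a b, inner ℝ (S a) b = inner ℝ a (S b) := fun a b => by
    rw [hSinner, real_inner_comm, ← hSinner, real_inner_comm]
  set w' : ℝ → H := (Icc 0 T).indicator w with hw'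
  have hw'i : Integrable w' := hw.integrable_indicator measurableSet_Icc
  set c : ℝ → H := fun t => ∫ s in (0 : ℝ)..t, w' s with hc
  have hcc : Continuous c :=
    intervalIntegral.continuous_primitive (fun a b => hw'i.intervalIntegrable) 0
  have hcw : ∀ t ∈ Icc 0 T, c t = ∫ s in (0 : ℝ)..t, w s := fun t ht =>
    intervalIntegral.integral_congr fun s hs => by
      rw [uIcc_of_le ht.1] at hs
      exact indicator_of_mem (show s ∈ Icc 0 T from ⟨hs.1, hs.2.trans ht.2⟩) w
  have h1c : (fun t => J (u t)) =ᵐ[timeMeasure T] c := by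
    filter_upwards [h1, ae_restrict_mem measurableSet_Icc] with t ht hI
    rw [ht, hcw t hI]
  have hSc : Continuous fun s => S (c s) - c s := (S.continuous.comp hcc).sub hcc
  set k : ℝ → H := fun t => ∫ s in (0 : ℝ)..t, (S (c s) - c s) with hk
  have hk' : ∀ t, HasDerivAt k (S (c t) - c t) t := fun t =>
    intervalIntegral.integral_hasDerivAt_right (hSc.intervalIntegrable _ _)
      (hSc.stronglyMeasurableAtFilter _ _) hSc.continuousAt
  have hkc : Continuous k := continuous_iff_continuousAt.2 fun t => (hk' t).continuousAt
  set h : ℝ → H := fun t => ∫ s in (0 : ℝ)..t, k s with hh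
  have hh' : ∀ t, HasDerivAt h (k t) t := fun t =>
    intervalIntegral.integral_hasDerivAt_right (hkc.intervalIntegrable _ _)
      (hkc.stronglyMeasurableAtFilter _ _) hkc.continuousAt
  have hae : ∀ t ∈ Icc 0 T, ∀ {p : ℝ → Prop}, (∀ᵐ s ∂timeMeasure T, p s) →
      ∀ᵐ s ∂volume.restrict (Ioc 0 t), p s := fun t ht p hp =>
    ae_restrict_of_ae_restrict_of_subset
      (Ioc_subset_Icc_self.trans (Icc_subset_Icc_right ht.2)) hp
  -- Testing with `v = J*b` turns `⟪u, v⟫` into `⟪Ju, b⟫`. So `Sw = k` weakly, where `k' = Sc - c`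
  -- and `c` is the continuous representative of `Ju`.
  have hwk : ∀ b, (fun t => inner ℝ (w t) (S b)) =ᵐ[timeMeasure T] fun t => inner ℝ (k t) b := by
    intro b
    filter_upwards [h2 (adjoint J b), ae_restrict_mem measurableSet_Icc] with t ht hI
    have e : inner ℝ (k t) b = ∫ s in (0 : ℝ)..t, inner ℝ b (S (c s) - c s) := by
      rw [real_inner_comm, hk]
      exact ((innerSL ℝ b).intervalIntegral_comp_comm (hSc.intervalIntegrable _ _)).symm
    rw [e, hS, ContinuousLinearMap.comp_apply, ht, intervalIntegral.integral_of_le hI.1,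
      intervalIntegral.integral_of_le hI.1]
    refine integral_congr_ae ?_
    filter_upwards [hae t hI h1c] with s hs
    rw [← hs, inner_sub_right, ← hSsymm, real_inner_comm, real_inner_comm (J (u s)) b,
      ContinuousLinearMap.adjoint_inner_right]
    rfl
  have hSh : ∀ t ∈ Icc 0 T, S (c t) = h t := by
    intro t ht
    refine ext_inner_left ℝ fun b => ?_
    have i1 : IntervalIntegrable w volume 0 t :=
      (intervalIntegrable_iff_integrableOn_Ioc_of_le ht.1).2
        (hw.mono_set (Ioc_subset_Icc_self.trans (Icc_subset_Icc_right ht.2)))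
    have e1 : inner ℝ (S b) (c t) = ∫ s in (0 : ℝ)..t, inner ℝ (S b) (w s) := by
      rw [hcw t ht]
      exact ((innerSL ℝ (S b)).intervalIntegral_comp_comm i1).symm
    have e2 : inner ℝ b (h t) = ∫ s in (0 : ℝ)..t, inner ℝ b (k s) := by
      rw [hh]
      exact ((innerSL ℝ b).intervalIntegral_comp_comm (hkc.intervalIntegrable _ _)).symm
    rw [← hSsymm, e1, e2, intervalIntegral.integral_of_le ht.1,
      intervalIntegral.integral_of_le ht.1]
    refine integral_congr_ae ?_
    filter_upwards [hae t ht (hwk b)] with s hs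
    rw [real_inner_comm, hs, real_inner_comm]
  -- With `h' = k` and `Sc = h` one has `Sk' = Sh - h`, so this energy is conserved. It dominates
  -- `‖J*k‖²` because `‖J*h‖ ≤ ‖h‖`.
  have hE : ∀ t, HasDerivAt (fun t => ‖adjoint J (k t)‖ ^ 2 + ‖h t‖ ^ 2 - ‖adjoint J (h t)‖ ^ 2)
      (2 * inner ℝ (adjoint J (k t)) (adjoint J (S (c t) - c t)) + 2 * inner ℝ (h t) (k t) -
        2 * inner ℝ (adjoint J (h t)) (adjoint J (k t))) t := fun t =>
    ((((adjoint J).hasFDerivAt.comp_hasDerivAt t (hk' t)).norm_sq).add (hh' t).norm_sq).sub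
      ((adjoint J).hasFDerivAt.comp_hasDerivAt t (hh' t)).norm_sq
  have hk0 : ∀ t ∈ Icc 0 T, k t = 0 := by
    intro t ht
    have hconst := constant_of_has_deriv_right_zero (a := 0) (b := T)
      (fun t _ => (hE t).continuousAt.continuousWithinAt) (fun t ht' => by
        have ht'' := Ico_subset_Icc_self ht'
        convert (hE t).hasDerivWithinAt using 1
        rw [← hSinner, ← hSinner, inner_sub_right, hSsymm (k t) (c t), hSh t ht'',
          hSsymm (h t) (k t), real_inner_comm (h t) (S (k t)), real_inner_comm (h t) (k t)]
        ring) t ht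
    simp only [hk, hh, intervalIntegral.integral_same, map_zero, norm_zero] at hconst
    refine injective_adjoint_of_denseRange hd (norm_eq_zero.1 ?_)
    have hle : ‖adjoint J (h t)‖ ≤ ‖h t‖ := by
      rcases (norm_nonneg (adjoint J (h t))).eq_or_lt with h0 | h0
      · rw [← h0]; exact norm_nonneg _
      · refine le_of_mul_le_mul_right ?_ h0
        have e : ‖adjoint J (h t)‖ * ‖adjoint J (h t)‖ = inner ℝ (h t) (J (adjoint J (h t))) := by
          rw [← ContinuousLinearMap.adjoint_inner_left, real_inner_self_eq_norm_mul_norm]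
        rw [e]
        exact (real_inner_le_norm _ _).trans
          (mul_le_mul_of_nonneg_left (hJ _) (norm_nonneg _))
    have hle2 := pow_le_pow_left₀ (norm_nonneg _) hle 2
    have hz : ‖adjoint J (k t)‖ ^ 2 = 0 :=
      le_antisymm (by simp only [hk, hh] at hle2 ⊢; linarith) (sq_nonneg _)
    exact pow_eq_zero_iff (two_ne_zero) |>.1 hz
  have hc0 : ∀ t ∈ Icc 0 T, c t = 0 := by
    intro t ht
    have hht : h t = 0 := by
      rw [hh]
      simp only
      rw [intervalIntegral.integral_congr (g := fun _ => 0)]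
      · simp
      · intro s hs
        rw [uIcc_of_le ht.1] at hs
        exact hk0 s ⟨hs.1, hs.2.trans ht.2⟩
    refine injective_adjoint_of_denseRange hd ?_
    rw [← inner_self_eq_zero (𝕜 := ℝ), ← hSinner, hSh t ht, hht, inner_zero_left]
  filter_upwards [h1c, ae_restrict_mem measurableSet_Icc] with t ht hI
  apply hinj
  rw [ht, hc0 t hI, Pi.zero_apply, map_zero]

/-- Uniqueness for the abstract wave equation `u'' + Λ u - u = f`. -/
theorem wave_unique {J : W →L[ℝ] H} (hJ : ∀ v, ‖J v‖ ≤ ‖v‖) (hinj : Function.Injective J)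
    (hd : DenseRange J) {T : ℝ} {u u' : ℝ → W} {w w' f : ℝ → H} {x₀ x₁ : H}
    (hf : IntegrableOn f (Icc 0 T))
    (hu : IntegrableOn u (Icc 0 T)) (hu' : IntegrableOn u' (Icc 0 T))
    (hw : IntegrableOn w (Icc 0 T)) (hw' : IntegrableOn w' (Icc 0 T))
    (h1 : (fun t => J (u t)) =ᵐ[timeMeasure T] fun t => x₀ + ∫ s in (0 : ℝ)..t, w s)
    (h1' : (fun t => J (u' t)) =ᵐ[timeMeasure T] fun t => x₀ + ∫ s in (0 : ℝ)..t, w' s)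
    (h2 : ∀ v, (fun t => inner ℝ (w t) (J v)) =ᵐ[timeMeasure T] fun t => inner ℝ x₁ (J v) +
      ∫ s in (0 : ℝ)..t, (inner ℝ (f s) (J v) + inner ℝ (J (u s)) (J v) - inner ℝ (u s) v))
    (h2' : ∀ v, (fun t => inner ℝ (w' t) (J v)) =ᵐ[timeMeasure T] fun t => inner ℝ x₁ (J v) +
      ∫ s in (0 : ℝ)..t, (inner ℝ (f s) (J v) + inner ℝ (J (u' s)) (J v) - inner ℝ (u' s) v)) :
    u =ᵐ[timeMeasure T] u' := by
  have hii : ∀ t ∈ Icc 0 T, ∀ {E : Type _} [NormedAddCommGroup E] {g : ℝ → E},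
      IntegrableOn g (Icc 0 T) → IntervalIntegrable g volume 0 t := fun t ht E _ g hg =>
    (intervalIntegrable_iff_integrableOn_Ioc_of_le ht.1).2
      (hg.mono_set (Ioc_subset_Icc_self.trans (Icc_subset_Icc_right ht.2)))
  have hint : ∀ {y : ℝ → W}, IntegrableOn y (Icc 0 T) → ∀ v, IntegrableOn (fun s =>
      inner ℝ (f s) (J v) + inner ℝ (J (y s)) (J v) - inner ℝ (y s) v) (Icc 0 T) := by
    intro y hy v
    refine Integrable.sub (Integrable.add ?_ ?_) ?_
    · exact hf.inner_const _
    · exact (J.integrable_comp hy).inner_const _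
    · exact hy.inner_const _
  have h := wave_eq_zero hJ hinj hd (u := fun t => u t - u' t) (w := fun t => w t - w' t)
    (hw.sub hw') (by
      filter_upwards [h1, h1', ae_restrict_mem measurableSet_Icc] with t e1 e2 ht
      rw [map_sub, e1, e2, add_sub_add_left_eq_sub, intervalIntegral.integral_sub]
      · exact (intervalIntegrable_iff_integrableOn_Ioc_of_le ht.1).2
          (hw.mono_set (Ioc_subset_Icc_self.trans (Icc_subset_Icc_right ht.2)))
      · exact (intervalIntegrable_iff_integrableOn_Ioc_of_le ht.1).2
          (hw'.mono_set (Ioc_subset_Icc_self.trans (Icc_subset_Icc_right ht.2)))) (fun v => by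
      filter_upwards [h2 v, h2' v, ae_restrict_mem measurableSet_Icc] with t e1 e2 ht
      rw [inner_sub_left, e1, e2, add_sub_add_left_eq_sub,
        ← intervalIntegral.integral_sub (hii t ht (hint hu v)) (hii t ht (hint hu' v))]
      refine intervalIntegral.integral_congr fun s _ => ?_
      simp only [map_sub, inner_sub_left]
      ring)
  filter_upwards [h] with t ht using sub_eq_zero.1 ht

end Uniqueness

/-! ### Real inner products from `𝕜`-valued ones. -/

section RealInner

variable (𝕜 E : Type*) [RCLike 𝕜] [NormedAddCommGroup E] [InnerProductSpace 𝕜 E]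
  [NormedSpace ℝ E] [IsScalarTower ℝ 𝕜 E]

/-- The real inner product `Re ⟪x, y⟫`, over the given real vector space structure. -/
noncomputable abbrev realInnerProductSpace : InnerProductSpace ℝ E where
  toNormedSpace := inferInstance
  inner x y := RCLike.re (inner 𝕜 x y)
  norm_sq_eq_re_inner x := norm_sq_eq_re_inner (𝕜 := 𝕜) x
  conj_inner_symm x y := inner_re_symm y x
  add_left x y z := by rw [inner_add_left, map_add]
  smul_left x y r := by
    rw [← algebraMap_smul 𝕜 r x, inner_smul_left]
    simp

end RealInner

/-! ### The energy norm and the antidual. -/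

section Energy

variable {𝕜 K H Y : Type*} [RCLike 𝕜] [NormedAddCommGroup K] [InnerProductSpace 𝕜 K]
  [NormedAddCommGroup H] [InnerProductSpace 𝕜 H]
  [NormedAddCommGroup Y] [InnerProductSpace 𝕜 Y] (m : K →L[𝕜] H)

/-- The space `K` with the norm `(‖u‖² + ‖m u‖²)^{1/2}`, realized as the graph of `m`. -/
noncomputable def graphSpace : Submodule 𝕜 (WithLp 2 (K × H)) :=
  (WithLp.sndL 2 𝕜 K H - m.comp (WithLp.fstL 2 𝕜 K H)).ker

instance [CompleteSpace K] [CompleteSpace H] : CompleteSpace (graphSpace m) :=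
  (ContinuousLinearMap.isClosed_ker _).completeSpace_coe

theorem snd_eq_of_mem_graphSpace (x : graphSpace m) : x.1.snd = m x.1.fst :=
  sub_eq_zero.1 x.2

/-- The projection of the graph of `m` to `K`. -/
noncomputable def ofGraph : graphSpace m →L[𝕜] K :=
  (WithLp.fstL 2 𝕜 K H).comp (graphSpace m).subtypeL

/-- The inverse of `ofGraph`. -/
noncomputable def toGraph : K →L[𝕜] graphSpace m :=
  (((WithLp.prodContinuousLinearEquiv 2 𝕜 K H).symm : (K × H) →L[𝕜] WithLp 2 (K × H)).comp
    ((ContinuousLinearMap.id 𝕜 _).prod m)).codRestrict (graphSpace m) fun _ => sub_eq_zero.2 rfl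

theorem ofGraph_toGraph (v : K) : ofGraph m (toGraph m v) = v := rfl

theorem toGraph_ofGraph (x : graphSpace m) : toGraph m (ofGraph m x) = x :=
  Subtype.ext (WithLp.ofLp_injective 2 (Prod.ext rfl (snd_eq_of_mem_graphSpace m x).symm))

theorem inner_graphSpace (x y : graphSpace m) :
    inner 𝕜 x y = inner 𝕜 (ofGraph m x) (ofGraph m y) +
      inner 𝕜 (m (ofGraph m x)) (m (ofGraph m y)) := by
  change inner 𝕜 x.1.fst y.1.fst + inner 𝕜 x.1.snd y.1.snd = _
  rw [snd_eq_of_mem_graphSpace, snd_eq_of_mem_graphSpace]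
  rfl

theorem norm_ofGraph_le (x : graphSpace m) : ‖ofGraph m x‖ ≤ ‖x‖ := WithLp.norm_fst_le _ x.1

/-- The map `Y → K*`, `y ↦ (v ↦ (y, L v))`, into the antidual. -/
noncomputable def antidualMap (L : K →L[𝕜] Y) : Y →L[𝕜] (K →L⋆[𝕜] 𝕜) :=
  LinearMap.mkContinuous
    { toFun := fun y => (innerSLFlip 𝕜 y).comp L
      map_add' := fun y z => by rw [map_add]; rfl
      map_smul' := fun c y => by rw [map_smul]; rfl } ‖L‖ fun y => by
    refine ContinuousLinearMap.opNorm_le_bound _ (by positivity) fun v => ?_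
    change ‖inner 𝕜 (L v) y‖ ≤ _
    refine (norm_inner_le_norm _ _).trans ?_
    nlinarith [L.le_opNorm v, norm_nonneg y]

theorem antidualMap_apply (L : K →L[𝕜] Y) (y : Y) (v : K) :
    antidualMap L y v = inner 𝕜 (L v) y := rfl

/-- The functional `ℓ ↦ Re ⟨ℓ, v⟩` on the antidual. -/
noncomputable def rePairing (v : K) : (K →L⋆[𝕜] 𝕜) →L[ℝ] ℝ :=
  LinearMap.mkContinuous
    { toFun := fun ℓ => RCLike.re (ℓ v)
      map_add' := fun ℓ m => by simp
      map_smul' := fun c ℓ => by simp [RCLike.smul_re] } ‖v‖ fun ℓ => by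
    refine (RCLike.norm_re_le_norm _).trans ?_
    rw [mul_comm]
    exact ℓ.le_opNorm v

theorem rePairing_apply (v : K) (ℓ : K →L⋆[𝕜] 𝕜) : rePairing v ℓ = RCLike.re (ℓ v) := rfl

/-- Conjugate-linearity gives `Re ℓ(iv) = Im ℓ(v)`, so real parts determine a functional. -/
theorem antidual_ext {ℓ m : K →L⋆[𝕜] 𝕜} (h : ∀ v, rePairing v ℓ = rePairing v m) : ℓ = m := by
  ext v
  refine RCLike.ext (h v) ?_
  have := h ((RCLike.I : 𝕜) • v)
  simpa [rePairing_apply] using this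

end Energy

/-! ### Weak solutions in a Gelfand triple. -/

section AbstractWave

variable {𝕜 K H Y : Type*} [RCLike 𝕜] [NormedAddCommGroup K] [InnerProductSpace 𝕜 K]
  [NormedAddCommGroup H] [InnerProductSpace 𝕜 H] [NormedAddCommGroup Y] [InnerProductSpace 𝕜 Y]
  (ι : K →L[𝕜] H) (γ : K →L[𝕜] Y) (m : K →L[𝕜] H)

/-- The form `a(u, v) = (γ u, γ v) + (m u, m v)` as a map into the antidual. -/
noncomputable def energyForm : K →L[𝕜] (K →L⋆[𝕜] 𝕜) :=
  (antidualMap γ).comp γ + (antidualMap m).comp m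

theorem energyForm_apply (u v : K) :
    energyForm γ m u v = inner 𝕜 (γ v) (γ u) + inner 𝕜 (m v) (m u) := rfl

variable {ι γ}

/-- The graph inner product contains the zeroth-order term `(ιu, ιv)`; removing it is the `-u` in
`u'' + Λu - u = f`. -/
theorem re_energyForm (hι : ∀ u v : K, inner 𝕜 u v = inner 𝕜 (ι u) (ι v) + inner 𝕜 (γ u) (γ v))
    (u v : K) : RCLike.re (energyForm γ m u v) =
      RCLike.re (inner 𝕜 (toGraph m u) (toGraph m v)) - RCLike.re (inner 𝕜 (ι u) (ι v)) := by
  rw [inner_graphSpace, ofGraph_toGraph, ofGraph_toGraph, hι, energyForm_apply, map_add, map_add,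
    map_add, inner_re_symm (𝕜 := 𝕜) (γ u), inner_re_symm (𝕜 := 𝕜) (m u)]
  ring

variable [CompleteSpace K] [CompleteSpace H] [NormedSpace ℝ K] [IsScalarTower ℝ 𝕜 K]
  [NormedSpace ℝ H] [IsScalarTower ℝ 𝕜 H]

omit [CompleteSpace K] [NormedSpace ℝ K] [IsScalarTower ℝ 𝕜 K] [CompleteSpace H]
  [NormedSpace ℝ H] [IsScalarTower ℝ 𝕜 H] in
theorem norm_le_of_inner_eq
    (hι : ∀ u v : K, inner 𝕜 u v = inner 𝕜 (ι u) (ι v) + inner 𝕜 (γ u) (γ v)) (v : K) :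
    ‖ι v‖ ≤ ‖v‖ := by
  refine le_of_sq_le_sq ?_ (norm_nonneg _)
  rw [← inner_self_eq_norm_sq (𝕜 := 𝕜) v, hι, map_add, inner_self_eq_norm_sq,
    inner_self_eq_norm_sq]
  linarith [sq_nonneg ‖γ v‖]

/-- The real theorem, applied on the graph of `m`, gives the velocity equation paired with each `v`
in real part. As the integrand is Bochner integrable in the antidual, these scalar identities
combine into one vector identity. -/
theorem exists_wave_antidual
    (hι : ∀ u v : K, inner 𝕜 u v = inner 𝕜 (ι u) (ι v) + inner 𝕜 (γ u) (γ v))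
    (hinj : Function.Injective ι) (hd : DenseRange ι) (u₀ : K) (u₁ : H) {T : ℝ} (hT : 0 ≤ T)
    {f : ℝ → H} (hf : IntegrableOn f (Icc 0 T)) :
    ∃ (u : ℝ → K) (w : ℝ → H) (M : ℝ), IntegrableOn u (Icc 0 T) ∧ IntegrableOn w (Icc 0 T) ∧
      (∀ t ∈ Icc 0 T, ‖u t‖ ≤ M ∧ ‖w t‖ ≤ M) ∧
      (∀ t ∈ Icc 0 T, ι (u t) = ι u₀ + ∫ s in (0 : ℝ)..t, w s) ∧
      ∀ t ∈ Icc 0 T, antidualMap ι (w t) = antidualMap ι u₁ +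
        ∫ s in (0 : ℝ)..t, (antidualMap ι (f s) - energyForm γ m (u s)) := by
  let : InnerProductSpace ℝ (graphSpace m) := realInnerProductSpace 𝕜 (graphSpace m)
  let : InnerProductSpace ℝ H := realInnerProductSpace 𝕜 H
  let J : graphSpace m →L[ℝ] H := (ι.comp (ofGraph m)).restrictScalars ℝ
  have hJ : ∀ v, ‖J v‖ ≤ ‖v‖ := fun v =>
    (norm_le_of_inner_eq hι _).trans (norm_ofGraph_le m v)
  have hJi : Function.Injective J :=
    hinj.comp (Function.LeftInverse.injective (toGraph_ofGraph m))
  have hJd : DenseRange J := hd.comp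
    (Function.RightInverse.surjective (ofGraph_toGraph m)).denseRange ι.continuous
  obtain ⟨u, w, M, hu, hw, hM, h1, h2⟩ := exists_wave hJ hJi hJd (toGraph m u₀) u₁ hT hf
  have hu' : IntegrableOn (fun t => ofGraph m (u t)) (Icc 0 T) :=
    (ofGraph m).integrable_comp hu
  refine ⟨fun t => ofGraph m (u t), w, M, hu', hw, fun t ht =>
    ⟨(norm_ofGraph_le m _).trans (hM t ht).1, (hM t ht).2⟩, h1, fun t ht => ?_⟩
  refine antidual_ext fun v => ?_
  have hi : IntegrableOn (fun s => antidualMap ι (f s) - energyForm γ m (ofGraph m (u s)))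
      (Icc 0 T) :=
    ((antidualMap ι).integrable_comp hf).sub ((energyForm γ m).integrable_comp hu')
  have hi' : IntervalIntegrable
      (fun s => antidualMap ι (f s) - energyForm γ m (ofGraph m (u s))) volume 0 t :=
    (intervalIntegrable_iff_integrableOn_Ioc_of_le ht.1).2
      (hi.mono_set (Ioc_subset_Icc_self.trans (Icc_subset_Icc_right ht.2)))
  rw [map_add, ← (rePairing v).intervalIntegral_comp_comm hi']
  have h := h2 t ht (toGraph m v)
  have e : ∀ h : H, rePairing v (antidualMap ι h) = inner ℝ h (J (toGraph m v)) := fun h => by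
    rw [rePairing_apply, antidualMap_apply, inner_re_symm (𝕜 := 𝕜)]; rfl
  rw [e, e, h]
  congr 1
  refine intervalIntegral.integral_congr fun s _ => ?_
  simp only [map_sub, e]
  rw [rePairing_apply, re_energyForm m hι, toGraph_ofGraph, add_sub_assoc,
    sub_sub_eq_add_sub, add_sub_assoc]
  rfl

theorem wave_unique_antidual
    (hι : ∀ u v : K, inner 𝕜 u v = inner 𝕜 (ι u) (ι v) + inner 𝕜 (γ u) (γ v))
    (hinj : Function.Injective ι) (hd : DenseRange ι) {x₀ x₁ : H} {T : ℝ}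
    {f : ℝ → H} (hf : IntegrableOn f (Icc 0 T)) {u u' : ℝ → K} {w w' : ℝ → H}
    (hu : IntegrableOn u (Icc 0 T)) (hu' : IntegrableOn u' (Icc 0 T))
    (hw : IntegrableOn w (Icc 0 T)) (hw' : IntegrableOn w' (Icc 0 T))
    (h1 : (fun t => ι (u t)) =ᵐ[timeMeasure T] fun t => x₀ + ∫ s in (0 : ℝ)..t, w s)
    (h1' : (fun t => ι (u' t)) =ᵐ[timeMeasure T] fun t => x₀ + ∫ s in (0 : ℝ)..t, w' s)
    (h2 : ∀ v, (fun t => rePairing v (antidualMap ι (w t))) =ᵐ[timeMeasure T] fun t =>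
      rePairing v (antidualMap ι x₁) + ∫ s in (0 : ℝ)..t,
        rePairing v (antidualMap ι (f s) - energyForm γ m (u s)))
    (h2' : ∀ v, (fun t => rePairing v (antidualMap ι (w' t))) =ᵐ[timeMeasure T] fun t =>
      rePairing v (antidualMap ι x₁) + ∫ s in (0 : ℝ)..t,
        rePairing v (antidualMap ι (f s) - energyForm γ m (u' s))) :
    u =ᵐ[timeMeasure T] u' := by
  let : InnerProductSpace ℝ (graphSpace m) := realInnerProductSpace 𝕜 (graphSpace m)
  let : InnerProductSpace ℝ H := realInnerProductSpace 𝕜 H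
  let J : graphSpace m →L[ℝ] H := (ι.comp (ofGraph m)).restrictScalars ℝ
  have hJ : ∀ v, ‖J v‖ ≤ ‖v‖ := fun v =>
    (norm_le_of_inner_eq hι _).trans (norm_ofGraph_le m v)
  have hJi : Function.Injective J :=
    hinj.comp (Function.LeftInverse.injective (toGraph_ofGraph m))
  have hJd : DenseRange J := hd.comp
    (Function.RightInverse.surjective (ofGraph_toGraph m)).denseRange ι.continuous
  have e : ∀ (h : H) (v : graphSpace m), rePairing (ofGraph m v) (antidualMap ι h) =
      inner ℝ h (J v) := fun h v => by
    rw [rePairing_apply, antidualMap_apply, inner_re_symm (𝕜 := 𝕜)]; rfl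
  have e2 : ∀ (h : H) (y : K) (v : graphSpace m),
      rePairing (ofGraph m v) (antidualMap ι h - energyForm γ m y) =
        inner ℝ h (J v) + inner ℝ (J (toGraph m y)) (J v) - inner ℝ (toGraph m y) v := by
    intro h y v
    rw [map_sub, e, rePairing_apply, re_energyForm m hι, toGraph_ofGraph, add_sub_assoc,
    sub_sub_eq_add_sub, add_sub_assoc]
    rfl
  have h := wave_unique hJ hJi hJd hf (u := fun t => toGraph m (u t))
    (u' := fun t => toGraph m (u' t)) ((toGraph m).integrable_comp hu)
    ((toGraph m).integrable_comp hu') hw hw' h1 h1'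
    (fun v => by simpa only [e, e2] using h2 (ofGraph m v))
    (fun v => by simpa only [e, e2] using h2' (ofGraph m v))
  filter_upwards [h] with t ht
  rw [← ofGraph_toGraph m (u t), ht, ofGraph_toGraph]

/-- Weak solutions of `u'' + a(u, ·) = f`, `u(0) = u₀`, `u'(0) = u₁` in a Gelfand triple. -/
def IsAbstractWeakSolution (ι : K →L[𝕜] H) (γ : K →L[𝕜] Y) (m : K →L[𝕜] H) (T : ℝ)
    (f : Lp H 2 (timeMeasure T)) (u₀ : K) (u₁ : H) (u : Lp K 2 (timeMeasure T)) : Prop :=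
  ∃ (u' : Lp H ∞ (timeMeasure T)) (u'' : Lp (K →L⋆[𝕜] 𝕜) 2 (timeMeasure T)),
    IsWeakTimeDeriv T (fun t => ι (u t)) u' ∧
    IsWeakTimeDeriv T (fun t => antidualMap ι (u' t)) u'' ∧
    HasInitialValue T (fun t => ι (u t)) (ι u₀) ∧
    HasInitialValue T (fun t => antidualMap ι (u' t)) (antidualMap ι u₁) ∧
    ∀ v : Lp K 2 (timeMeasure T),
      ∫ t in Icc 0 T, (u'' t (v t) + inner 𝕜 (γ (v t)) (γ (u t)) + inner 𝕜 (m (v t)) (m (u t)))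
        = ∫ t in Icc 0 T, inner 𝕜 (ι (v t)) (f t)

omit [CompleteSpace H] [NormedSpace ℝ K] [IsScalarTower ℝ 𝕜 K] [InnerProductSpace 𝕜 H]
  [IsScalarTower ℝ 𝕜 H] in
theorem IsWeakTimeDeriv.congr_ae {T : ℝ} {w w' g g' : ℝ → H} (h : IsWeakTimeDeriv T w g)
    (hw : w' =ᵐ[timeMeasure T] w) (hg : g' =ᵐ[timeMeasure T] g) : IsWeakTimeDeriv T w' g' := by
  intro φ h1 h2 h3
  have e1 : ∫ t in Icc 0 T, deriv φ t • w' t = ∫ t in Icc 0 T, deriv φ t • w t :=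
    integral_congr_ae (by filter_upwards [hw] with t ht; rw [ht])
  have e2 : ∫ t in Icc 0 T, φ t • g' t = ∫ t in Icc 0 T, φ t • g t :=
    integral_congr_ae (by filter_upwards [hg] with t ht; rw [ht])
  rw [e1, e2, h φ h1 h2 h3]

theorem HasInitialValue.congr_ae {X : Type*} [TopologicalSpace X] {T : ℝ} {w w' : ℝ → X} {x : X}
    (h : HasInitialValue T w x) (hw : w' =ᵐ[timeMeasure T] w) : HasInitialValue T w' x := by
  obtain ⟨c, h1, h2, h3⟩ := h
  exact ⟨c, h1, h2.trans hw.symm, h3⟩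

theorem exists_isAbstractWeakSolution
    (hι : ∀ u v : K, inner 𝕜 u v = inner 𝕜 (ι u) (ι v) + inner 𝕜 (γ u) (γ v))
    (hinj : Function.Injective ι) (hd : DenseRange ι) {T : ℝ} (hT : 0 ≤ T)
    (f : Lp H 2 (timeMeasure T)) (u₀ : K) (u₁ : H) :
    ∃ u, IsAbstractWeakSolution ι γ m T f u₀ u₁ u := by
  have hf : IntegrableOn f (Icc 0 T) := (Lp.memLp f).integrable (by norm_num)
  obtain ⟨u, w, M, hu, hw, hM, h1, h2⟩ := exists_wave_antidual m hι hinj hd u₀ u₁ hT hf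
  have mu : MemLp u 2 (timeMeasure T) := MemLp.of_bound hu.aestronglyMeasurable M (by
    filter_upwards [ae_restrict_mem measurableSet_Icc] with t ht using (hM t ht).1)
  have mw : MemLp w ∞ (timeMeasure T) := memLp_top_of_bound hw.aestronglyMeasurable M (by
    filter_upwards [ae_restrict_mem measurableSet_Icc] with t ht using (hM t ht).2)
  -- The second derivative is defined by the equation itself, so the weak formulation will hold by
  -- construction.
  have mg : MemLp (fun s => antidualMap ι (f s) - energyForm γ m (u s)) 2 (timeMeasure T) :=
    ((antidualMap ι).comp_memLp' (Lp.memLp f)).sub ((energyForm γ m).comp_memLp' mu)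
  have hg : IntegrableOn (fun s => antidualMap ι (f s) - energyForm γ m (u s)) (Icc 0 T) :=
    mg.integrable (by norm_num)
  have eu := mu.coeFn_toLp
  have ew := mw.coeFn_toLp
  have eιu : (fun t => ι (mu.toLp u t)) =ᵐ[timeMeasure T] fun t => ι (u t) := by
    filter_upwards [eu] with t ht; rw [ht]
  have eιw : (fun t => antidualMap ι (mw.toLp w t)) =ᵐ[timeMeasure T]
      fun t => antidualMap ι (w t) := by
    filter_upwards [ew] with t ht; rw [ht]
  refine ⟨mu.toLp u, mw.toLp w, mg.toLp _, ?_, ?_, ?_, ?_, fun v => ?_⟩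
  · exact ((isWeakTimeDeriv_primitive hT hw (ι u₀)).congr_left h1).congr_ae eιu ew
  · exact ((isWeakTimeDeriv_primitive hT hg (antidualMap ι u₁)).congr_left h2).congr_ae eιw
      mg.coeFn_toLp
  · exact (hasInitialValue_of_integral hT hw h1).congr_ae eιu
  · exact (hasInitialValue_of_integral hT hg h2).congr_ae eιw
  · refine integral_congr_ae ?_
    filter_upwards [eu, mg.coeFn_toLp] with t e1 e2
    rw [e1, e2, add_assoc, ← energyForm_apply]
    change antidualMap ι (f t) (v t) - energyForm γ m (u t) (v t) + _ = _
    rw [sub_add_cancel, antidualMap_apply]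

omit [CompleteSpace K] [CompleteSpace H] [NormedSpace ℝ K] [IsScalarTower ℝ 𝕜 K]
  [NormedSpace ℝ H] [IsScalarTower ℝ 𝕜 H] in
/-- The weak formulation holds pointwise in time. -/
theorem ae_eq_of_integral_eq {T : ℝ} {f : Lp H 2 (timeMeasure T)} {u : Lp K 2 (timeMeasure T)}
    {u'' : Lp (K →L⋆[𝕜] 𝕜) 2 (timeMeasure T)}
    (h : ∀ v : Lp K 2 (timeMeasure T),
      ∫ t in Icc 0 T, (u'' t (v t) + inner 𝕜 (γ (v t)) (γ (u t)) + inner 𝕜 (m (v t)) (m (u t)))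
        = ∫ t in Icc 0 T, inner 𝕜 (ι (v t)) (f t)) (v : K) :
    (fun t => u'' t v) =ᵐ[timeMeasure T]
      fun t => (antidualMap ι (f t) - energyForm γ m (u t)) v := by
  have hev : ∀ g : ℝ → (K →L⋆[𝕜] 𝕜), Integrable g (timeMeasure T) →
      Integrable (fun t => g t v) (timeMeasure T) := fun g hg =>
    (ContinuousLinearMap.apply' 𝕜 (starRingEnd 𝕜) v).integrable_comp hg
  have iu : Integrable u (timeMeasure T) := (Lp.memLp u).integrable (by norm_num)
  have i1 : Integrable (fun t => (u'' t + energyForm γ m (u t)) v) (timeMeasure T) :=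
    hev _ (((Lp.memLp u'').integrable (by norm_num)).add ((energyForm γ m).integrable_comp iu))
  have i2 : Integrable (fun t => antidualMap ι (f t) v) (timeMeasure T) :=
    hev _ ((antidualMap ι).integrable_comp ((Lp.memLp f).integrable (by norm_num)))
  have key : (fun t => (u'' t + energyForm γ m (u t)) v) =ᵐ[timeMeasure T]
      fun t => antidualMap ι (f t) v := by
    refine Integrable.ae_eq_of_forall_setIntegral_eq _ _ i1 i2 fun s hs _ => ?_
    -- The test function `1_s(t) v` localizes the identity to an arbitrary measurable set of times.
    have hv := h (indicatorConstLp 2 hs (measure_ne_top _ _) v)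
    rw [← integral_indicator hs, ← integral_indicator hs]
    convert hv using 1
    · refine integral_congr_ae ?_
      filter_upwards [indicatorConstLp_coeFn (p := 2) (hs := hs)
        (hμs := measure_ne_top (timeMeasure T) s) (c := v)] with t ht
      rw [ht]
      by_cases hts : t ∈ s
      · simp only [indicator_of_mem hts, add_assoc, ← energyForm_apply]; rfl
      · simp [indicator_of_notMem hts]
    · refine integral_congr_ae ?_
      filter_upwards [indicatorConstLp_coeFn (p := 2) (hs := hs)
        (hμs := measure_ne_top (timeMeasure T) s) (c := v)] with t ht
      rw [ht]
      by_cases hts : t ∈ s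
      · simp only [indicator_of_mem hts, antidualMap_apply]
      · simp [indicator_of_notMem hts]
  filter_upwards [key] with t ht
  change _ = antidualMap ι (f t) v - energyForm γ m (u t) v
  rw [← ht]
  change _ = u'' t v + energyForm γ m (u t) v - energyForm γ m (u t) v
  rw [add_sub_cancel_right]

theorem IsAbstractWeakSolution.unique
    (hι : ∀ u v : K, inner 𝕜 u v = inner 𝕜 (ι u) (ι v) + inner 𝕜 (γ u) (γ v))
    (hinj : Function.Injective ι) (hd : DenseRange ι) {T : ℝ} (hT : 0 < T)
    {f : Lp H 2 (timeMeasure T)} {u₀ : K} {u₁ : H} {u v : Lp K 2 (timeMeasure T)}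
    (hu : IsAbstractWeakSolution ι γ m T f u₀ u₁ u)
    (hv : IsAbstractWeakSolution ι γ m T f u₀ u₁ v) : u = v := by
  have main : ∀ {u : Lp K 2 (timeMeasure T)}, IsAbstractWeakSolution ι γ m T f u₀ u₁ u →
      ∃ w : ℝ → H, IntegrableOn w (Icc 0 T) ∧
        ((fun t => ι (u t)) =ᵐ[timeMeasure T] fun t => ι u₀ + ∫ s in (0 : ℝ)..t, w s) ∧
        ∀ v, (fun t => rePairing v (antidualMap ι (w t))) =ᵐ[timeMeasure T] fun t =>
          rePairing v (antidualMap ι u₁) + ∫ s in (0 : ℝ)..t,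
            rePairing v (antidualMap ι (f s) - energyForm γ m (u s)) := by
    rintro u ⟨u', u'', h1, h2, h3, h4, h5⟩
    have iu : IntegrableOn u (Icc 0 T) := (Lp.memLp u).integrable (by norm_num)
    have iw : IntegrableOn u' (Icc 0 T) := (Lp.memLp u').integrable le_top
    have ig : IntegrableOn u'' (Icc 0 T) := (Lp.memLp u'').integrable (by norm_num)
    refine ⟨u', iw, h1.ae_eq_primitive hT (ι.integrable_comp iu) iw h3, fun v => ?_⟩
    filter_upwards [h2.ae_eq_primitive hT ((antidualMap ι).integrable_comp iw) ig h4,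
      ae_restrict_mem measurableSet_Icc] with t ht hI
    have hsub : Ioc 0 t ⊆ Icc 0 T := Ioc_subset_Icc_self.trans (Icc_subset_Icc_right hI.2)
    rw [ht, map_add, ← (rePairing v).intervalIntegral_comp_comm
      ((intervalIntegrable_iff_integrableOn_Ioc_of_le hI.1).2 (ig.mono_set hsub)),
      intervalIntegral.integral_of_le hI.1, intervalIntegral.integral_of_le hI.1]
    congr 1
    refine integral_congr_ae (ae_restrict_of_ae_restrict_of_subset hsub ?_)
    filter_upwards [ae_eq_of_integral_eq m h5 v] with s hs
    rw [rePairing_apply, hs, rePairing_apply]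
  obtain ⟨w, iw, h1, h2⟩ := main hu
  obtain ⟨w', iw', h1', h2'⟩ := main hv
  refine Lp.ext (wave_unique_antidual m hι hinj hd ((Lp.memLp f).integrable (by norm_num))
    ((Lp.memLp u).integrable (by norm_num)) ((Lp.memLp v).integrable (by norm_num))
    iw iw' h1 h1' h2 h2')

end AbstractWave

/-! ### The embedding of `H¹₀(Ω)` in `L²(Ω)` and the potential. -/

section Space

variable {𝕜 : Type*} [RCLike 𝕜] {n : ℕ} {Ω : Set (EuclideanSpace ℝ (Fin n))}

theorem isTestFunction_ofReal {g : EuclideanSpace ℝ (Fin n) → ℝ} (h1 : ContDiff ℝ ∞ g)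
    (h2 : HasCompactSupport g) (h3 : tsupport g ⊆ Ω) :
    IsTestFunction Ω fun x => (g x : 𝕜) where
  smooth := (RCLike.ofRealCLM (K := 𝕜)).contDiff.comp h1
  compact := h2.comp_left (g := fun r : ℝ => (r : 𝕜)) (by simp)
  subset := by
    refine (closure_mono fun x hx h => ?_).trans h3
    exact hx (by simp only [h, RCLike.ofReal_zero])

/-- The fundamental lemma of the calculus of variations. -/
theorem ae_eq_zero_of_integral_testFunction (hΩ : IsOpen Ω) {h : EuclideanSpace ℝ (Fin n) → 𝕜}
    (hh : IntegrableOn h Ω) (h0 : ∀ g : EuclideanSpace ℝ (Fin n) → ℝ,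
      IsTestFunction Ω (fun x => (g x : 𝕜)) → ∫ x in Ω, (g x : 𝕜) * h x = 0) :
    h =ᵐ[volume.restrict Ω] 0 := by
  rw [EventuallyEq, ae_restrict_iff' hΩ.measurableSet]
  refine hΩ.ae_eq_zero_of_integral_contDiff_smul_eq_zero hh.locallyIntegrableOn
    fun g h1 h2 h3 => ?_
  rw [← h0 g (isTestFunction_ofReal h1 h2 h3), setIntegral_eq_integral_of_forall_compl_eq_zero]
  · simp only [RCLike.real_smul_eq_coe_mul]
  · intro x hx
    rw [image_eq_zero_of_notMem_tsupport fun h' => hx (h3 h')]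
    simp

theorem isFiniteMeasure_restrict_of_isBounded (hΩ : Bornology.IsBounded Ω) :
    IsFiniteMeasure (volume.restrict Ω) :=
  isFiniteMeasure_restrict.2 hΩ.measure_lt_top.ne

/-- An element is a pair `(u, ∇u)`, so `u = 0` must also force the second component to vanish: it is
a weak gradient of zero, and the fundamental lemma applies. -/
theorem injective_toL2 (hΩ : IsOpen Ω) (hb : Bornology.IsBounded Ω) :
    Function.Injective (toL2 (𝕜 := 𝕜) (Ω := Ω)) := by
  have := isFiniteMeasure_restrict_of_isBounded hb
  rw [injective_iff_map_eq_zero]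
  rintro ⟨p, hp⟩ hp0
  have h1 : p.fst = 0 := hp0
  have hG := isWeakGrad_of_mem_H10 hp
  have h2 : p.snd = 0 := by
    rw [Lp.eq_zero_iff_ae_eq_zero]
    have hi : ∀ i, (fun x => p.snd x i) =ᵐ[volume.restrict Ω] 0 := by
      intro i
      refine ae_eq_zero_of_integral_testFunction hΩ ?_ fun g hg => ?_
      · exact ((EuclideanSpace.proj (𝕜 := 𝕜) i).comp_memLp' (Lp.memLp p.snd)).integrable
          (by norm_num)
      · have h := hG _ hg i
        have h0 : ∫ x in Ω, p.fst x * fderiv ℝ (fun x => (g x : 𝕜)) x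
            (EuclideanSpace.single i 1) = 0 := by
          rw [h1]
          refine integral_eq_zero_of_ae ?_
          filter_upwards [Lp.coeFn_zero 𝕜 2 (volume.restrict Ω)] with x hx
          rw [hx]; simp
        rw [h0] at h
        rw [← neg_eq_zero, h]
        simp only [mul_comm]
    filter_upwards [ae_all_iff.2 hi] with x hx
    ext i
    exact hx i
  exact Subtype.ext (WithLp.ofLp_injective 2 (Prod.ext h1 h2))

theorem denseRange_toL2 (hΩ : IsOpen Ω) (hb : Bornology.IsBounded Ω) :
    DenseRange (toL2 (𝕜 := 𝕜) (Ω := Ω)) := by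
  have := isFiniteMeasure_restrict_of_isBounded hb
  refine denseRange_of_forall_inner_eq_zero _ fun y hy => ?_
  rw [Lp.eq_zero_iff_ae_eq_zero]
  refine ae_eq_zero_of_integral_testFunction hΩ ((Lp.memLp y).integrable (by norm_num))
    fun g hg => ?_
  obtain ⟨p, hp, hp1, -⟩ := exists_mem_H10_of_isTestFunction hg
  have h := hy ⟨p, hp⟩
  rw [L2.inner_def] at h
  rw [← h]
  refine integral_congr_ae ?_
  filter_upwards [hp1] with x hx
  change _ = inner 𝕜 (p.fst x) (y x)
  rw [hx, RCLike.inner_apply, RCLike.conj_ofReal, mul_comm]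

theorem inner_H10 (u v : H10 𝕜 Ω) :
    inner 𝕜 u v = inner 𝕜 (toL2 u) (toL2 v) + inner 𝕜 (grad u) (grad v) := rfl

instance : CompleteSpace (H10 𝕜 Ω) :=
  (Submodule.isClosed_topologicalClosure _).completeSpace_coe

theorem memLp_sqrt (V : Lp ℝ ∞ (volume.restrict Ω)) :
    MemLp (fun x => (Real.sqrt (V x) : 𝕜)) ∞ (volume.restrict Ω) := by
  refine memLp_top_of_bound (C := Real.sqrt (eLpNorm V ∞ (volume.restrict Ω)).toReal) ?_ ?_
  · exact (RCLike.continuous_ofReal.comp Real.continuous_sqrt).comp_aestronglyMeasurable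
      (Lp.aestronglyMeasurable V)
  · filter_upwards [ae_le_eLpNormEssSup (f := V) (μ := volume.restrict Ω)] with x hx
    rw [RCLike.norm_ofReal, abs_of_nonneg (Real.sqrt_nonneg _)]
    refine Real.sqrt_le_sqrt ((le_abs_self _).trans ?_)
    rw [← eLpNorm_exponent_top] at hx
    simpa using ENNReal.toReal_mono (Lp.eLpNorm_ne_top V) hx

/-- Multiplication by `√V` on `L²(Ω)`. -/
noncomputable def sqrtMul (V : Lp ℝ ∞ (volume.restrict Ω)) : L2 𝕜 Ω →L[𝕜] L2 𝕜 Ω :=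
  (ContinuousLinearMap.mul 𝕜 𝕜).holderL (volume.restrict Ω) ∞ 2 2 ((memLp_sqrt V).toLp _)

theorem coeFn_sqrtMul (V : Lp ℝ ∞ (volume.restrict Ω)) (u : L2 𝕜 Ω) :
    sqrtMul V u =ᵐ[volume.restrict Ω] fun x => (Real.sqrt (V x) : 𝕜) * u x := by
  filter_upwards [(ContinuousLinearMap.mul 𝕜 𝕜).coeFn_holder (r := 2)
    ((memLp_sqrt (𝕜 := 𝕜) V).toLp _) u, (memLp_sqrt (𝕜 := 𝕜) V).coeFn_toLp] with x h1 h2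
  rw [← h2]
  exact h1

theorem potentialForm_eq_inner (V : Lp ℝ ∞ (volume.restrict Ω)) (u v : L2 𝕜 Ω) :
    potentialForm V u v = inner 𝕜 (sqrtMul V v) (sqrtMul V u) := by
  rw [L2.inner_def, potentialForm]
  refine integral_congr_ae ?_
  filter_upwards [coeFn_sqrtMul V u, coeFn_sqrtMul V v] with x h1 h2
  rw [h1, h2]

end Space

/-! ### The Dirichlet problem as an instance of the abstract one. -/

section Main

variable {𝕜 : Type*} [RCLike 𝕜] {n : ℕ} {Ω : Set (EuclideanSpace ℝ (Fin n))}
  {T : ℝ} (V : Lp ℝ ∞ (volume.restrict Ω)) (f : Lp (L2 𝕜 Ω) 2 (timeMeasure T))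
  (u₀ : H10 𝕜 Ω) (u₁ : L2 𝕜 Ω)

theorem isWeakSolution_iff {u : Lp (H10 𝕜 Ω) 2 (timeMeasure T)} :
    IsWeakSolution T V f u₀ u₁ u ↔
      IsAbstractWeakSolution toL2 grad ((sqrtMul V).comp toL2) T f u₀ u₁ u := by
  simp only [IsWeakSolution, potentialForm_eq_inner]
  rfl

theorem exists_isWeakSolution (hΩ : IsOpen Ω) (hb : Bornology.IsBounded Ω) (hT : 0 ≤ T) :
    ∃ u, IsWeakSolution T V f u₀ u₁ u :=
  (exists_isAbstractWeakSolution (K := H10 𝕜 Ω) (H := L2 𝕜 Ω) (Y := L2Vec 𝕜 Ω) (ι := toL2)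
    (γ := grad) ((sqrtMul V).comp toL2) inner_H10 (injective_toL2 hΩ hb) (denseRange_toL2 hΩ hb)
    hT f u₀ u₁).imp fun _ => (isWeakSolution_iff V f u₀ u₁).2

theorem IsWeakSolution.unique (hΩ : IsOpen Ω) (hb : Bornology.IsBounded Ω) (hT : 0 < T)
    {u v : Lp (H10 𝕜 Ω) 2 (timeMeasure T)} (hu : IsWeakSolution T V f u₀ u₁ u)
    (hv : IsWeakSolution T V f u₀ u₁ v) : u = v :=
  IsAbstractWeakSolution.unique (K := H10 𝕜 Ω) (H := L2 𝕜 Ω) (Y := L2Vec 𝕜 Ω) (ι := toL2)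
    (γ := grad) ((sqrtMul V).comp toL2) inner_H10 (injective_toL2 hΩ hb) (denseRange_toL2 hΩ hb)
    hT ((isWeakSolution_iff V f u₀ u₁).1 hu) ((isWeakSolution_iff V f u₀ u₁).1 hv)

end Main

end WaveDirichlet

theorem mainTheorem5 {𝕜 : Type*} [RCLike 𝕜] {n : ℕ} (Ω : Set (EuclideanSpace ℝ (Fin n)))
    (hΩ_open : IsOpen Ω) (hΩ_conn : IsConnected Ω) (hΩ_bdd : Bornology.IsBounded Ω)
    (T : ℝ) (hT : 0 < T)
    (V : MeasureTheory.Lp ℝ ⊤ (MeasureTheory.volume.restrict Ω)) (hV : 0 ≤ V)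
    (f : MeasureTheory.Lp (WaveDirichlet.L2 𝕜 Ω) 2 (WaveDirichlet.timeMeasure T))
    (u₀ : WaveDirichlet.H10 𝕜 Ω) (u₁ : WaveDirichlet.L2 𝕜 Ω) :
    ∃! u : MeasureTheory.Lp (WaveDirichlet.H10 𝕜 Ω) 2 (WaveDirichlet.timeMeasure T),
      WaveDirichlet.IsWeakSolution T V f u₀ u₁ u :=
  existsUnique_of_exists_of_unique
    (WaveDirichlet.exists_isWeakSolution V f u₀ u₁ hΩ_open hΩ_bdd hT.le)
    fun _ _ hu hv => WaveDirichlet.IsWeakSolution.unique V f u₀ u₁ hΩ_open hΩ_bdd hT hu hv
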